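/- Let $G$ be a Polish group and let $(X,\mu)$ be a standard probability space, i.e. $X$ is a standard Borel space and $\mu$ is a non-atomic Borel probability measure on $X$. Let $G$ act on $X$ in such a way that the action map $G\times X\to X$ is Borel and $\mu(gA)=\mu(A)$ for all $g\in G$ and all Borel $A\subseteq X$. Assume that the action is \emph{suitable} (in the sense of Becker): for all Borel sets $A,B\subseteq X$ of positive measure, at least one of the following holds: (1) for every open neighborhood $O$ of the identity in $G$ there is $g\in O$ such that $\mu(A\cap gB)>0$; (2) there are Borel sets $A'\subseteq A$ and $B'\subseteq B$ with $\mu(A\setminus A')=\mu(B\setminus B')=0$ and an open neighborhood $O$ of the identity in $G$ such that $(OA')\cap B'=\emptyset$. Let $\mathrm{Aut}(X,\mu)$ be the group of all measure-preserving Borel bijections of $(X,\mu)$, where two such bijections are identified if they coincide on a set of full measure. For a subgroup $H\le G$ let the orbit full group of $H$ be $$[\mathcal R_H]=\{T\in \mathrm{Aut}(X,\mu): T(x)\in H\cdot x \text{ for every } x\in X\}$$ (that is, the set of classes having a representative with this property), so that $[\mathcal R_H]\le[\mathcal R_G]$. Equip $[\mathcal R_G]$ with the topology of convergence in measure, which is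 defined as follows. Let $d$ be any bounded metric on $G$ that induces the topology of $G$, and equip the space $\mathrm L^0(X,\mu,G)$ of (classes of) measurable functions $X\to G$ with the metric $\tilde d(f,f')=\int_X d(f(x),f'(x))\,d\mu(x)$. For $f\in \mathrm L^0(X,\mu,G)$ put $\Phi(f)(x)=f(x)\cdot x$, and let $\widetilde{[\mathcal R_G]}=\Phi^{-1}([\mathcal R_G])\subseteq \mathrm L^0(X,\mu,G)$ carry the topology given by $\tilde d$. The topology of $[\mathcal R_G]$ is the quotient topology induced by $\Phi:\widetilde{[\mathcal R_G]}\to[\mathcal R_G]$; it does not depend on the choice of $d$. Then for every dense subgroup $H\le G$, the orbit full group $[\mathcal R_H]$ is dense in $[\mathcal R_G]$. -/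

import Mathlib

open MeasureTheory Topology
open scoped Pointwise

namespace OrbitFullGroup

section Aut

variable {X : Type*} [MeasurableSpace X]

/-- The group of Borel bijections of `X` (with Borel inverse) that preserve the measure `μ`. -/
def mpBij (μ : Measure X) : Subgroup (Equiv.Perm X) where
  carrier := {S | MeasurePreserving S μ μ ∧ Measurable S.symm}
  one_mem' := ⟨MeasurePreserving.id μ, measurable_id⟩
  mul_mem' := fun ha hb => ⟨ha.1.comp hb.1, hb.2.comp ha.2⟩
  inv_mem' := fun {S} hS =>
    ⟨MeasurePreserving.symm
      ({ toEquiv := S, measurable_toFun := hS.1.measurable, measurable_invFun := hS.2 } : X ≃ᵐ X)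
      hS.1, hS.1.measurable⟩

/-- The measure-preserving Borel bijections that coincide almost everywhere with the identity. -/
def aeTrivial (μ : Measure X) : Subgroup (mpBij μ) where
  carrier := {S | ∀ᵐ x ∂μ, S.1 x = x}
  one_mem' := by
    change ∀ᵐ x ∂μ, x = x
    exact Filter.Eventually.of_forall fun _ => rfl
  mul_mem' := fun {a b} ha hb => by
    have ha' : ∀ᵐ x ∂μ, a.1 x = x := ha
    have hb' : ∀ᵐ x ∂μ, b.1 x = x := hb
    change ∀ᵐ x ∂μ, a.1 (b.1 x) = x
    filter_upwards [ha', hb'] with x h1 h2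
    rw [h2, h1]
  inv_mem' := fun {a} ha => by
    have ha' : ∀ᵐ x ∂μ, a.1 x = x := ha
    change ∀ᵐ x ∂μ, a.1.symm x = x
    filter_upwards [ha'] with x h1
    rw [Equiv.symm_apply_eq, h1]

instance aeTrivial_normal (μ : Measure X) : (aeTrivial μ).Normal where
  conj_mem := fun a ha b => by
    have ha' : ∀ᵐ x ∂μ, a.1 x = x := ha
    have hb : MeasurePreserving b.1.symm μ μ := ((mpBij μ).inv_mem b.2).1
    change ∀ᵐ x ∂μ, b.1 (a.1 (b.1.symm x)) = x
    filter_upwards [hb.quasiMeasurePreserving.ae ha'] with x hx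
    rw [hx, Equiv.apply_symm_apply]

/-- `Aut(X, μ)`: the group of measure-preserving Borel bijections of `(X, μ)`, two such bijections
being identified if they coincide almost everywhere. -/
abbrev Aut (μ : Measure X) : Type _ := mpBij μ ⧸ aeTrivial μ

theorem aut_eq_iff (μ : Measure X) (S T : mpBij μ) :
    (QuotientGroup.mk S : Aut μ) = QuotientGroup.mk T ↔ ∀ᵐ x ∂μ, S.1 x = T.1 x := by
  rw [QuotientGroup.eq]
  change (∀ᵐ x ∂μ, S.1.symm (T.1 x) = x) ↔ _
  refine Filter.eventually_congr (Filter.Eventually.of_forall fun x => ?_)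
  rw [Equiv.symm_apply_eq, eq_comm]

/-- The orbit full group `[R_Γ]`: the elements of `Aut(X, μ)` (that is, the classes of bijections
`S`) such that `S x ∈ Γ • x` for every `x`. -/
def orbitFullGroup (Γ : Type*) [Group Γ] [MulAction Γ X] (μ : Measure X) : Subgroup (Aut μ) :=
  Subgroup.map (QuotientGroup.mk' (aeTrivial μ))
    { carrier := {S : mpBij μ | ∀ x, S.1 x ∈ MulAction.orbit Γ x}
      one_mem' := fun x => MulAction.mem_orbit_self x
      mul_mem' := fun {a b} ha hb x => by
        have h1 := ha (b.1 x)
        rw [MulAction.orbit_eq_iff.2 (hb x)] at h1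
        exact h1
      inv_mem' := fun {a} ha x => by
        have h1 := ha (a.1.symm x)
        rw [Equiv.apply_symm_apply] at h1
        exact MulAction.mem_orbit_symm.1 h1 }

theorem mem_orbitFullGroup {Γ : Type*} [Group Γ] [MulAction Γ X] {μ : Measure X} {T : Aut μ} :
    T ∈ orbitFullGroup Γ μ ↔
      ∃ S : mpBij μ, (∀ x, S.1 x ∈ MulAction.orbit Γ x) ∧ (QuotientGroup.mk S : Aut μ) = T :=
  Iff.rfl

/-- `[R_H]` is contained in `[R_G]` for every subgroup `H` of `G`. -/
theorem orbitFullGroup_subgroup_le {G : Type*} [Group G] [MulAction G X] (H : Subgroup G)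
    (μ : Measure X) : orbitFullGroup H μ ≤ orbitFullGroup G μ := by
  rintro T ⟨S, hS, rfl⟩
  refine ⟨S, fun x => ?_, rfl⟩
  obtain ⟨h, hh⟩ := hS x
  exact ⟨h.1, hh⟩

end Aut

/-- A Borel measure-preserving action of `G` on `(X, μ)` is suitable (Becker) if for all Borel sets
`A`, `B` of positive measure, either every open neighbourhood of the identity contains `g` with
`μ (A ∩ g • B) > 0`, or there are Borel `A' ⊆ A` and `B' ⊆ B` of full measure in `A` and `B` and
an open neighbourhood `O` of the identity with `(O • A') ∩ B' = ∅`. -/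
def IsSuitable (G : Type*) {X : Type*} [Group G] [TopologicalSpace G] [MeasurableSpace X]
    [MulAction G X] (μ : Measure X) : Prop :=
  ∀ A B : Set X, MeasurableSet A → MeasurableSet B → 0 < μ A → 0 < μ B →
    (∀ O : Set G, IsOpen O → (1 : G) ∈ O → ∃ g ∈ O, 0 < μ (A ∩ g • B)) ∨
    (∃ A' B' : Set X, ∃ O : Set G,
      MeasurableSet A' ∧ MeasurableSet B' ∧ A' ⊆ A ∧ B' ⊆ B ∧ μ (A \ A') = 0 ∧ μ (B \ B') = 0 ∧
      IsOpen O ∧ (1 : G) ∈ O ∧ (O • A') ∩ B' = ∅)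

/-- The topology given by a distance function `δ`: a set is open if around each of its points it
contains a `δ`-ball of positive radius. -/
@[reducible]
def distTopology {Y : Type*} (δ : Y → Y → ℝ) : TopologicalSpace Y where
  IsOpen U := ∀ y ∈ U, ∃ ε > 0, ∀ z, δ y z < ε → z ∈ U
  isOpen_univ := fun _ _ => ⟨1, one_pos, fun _ _ => trivial⟩
  isOpen_inter := fun U V hU hV y hy => by
    obtain ⟨ε, hε, h1⟩ := hU y hy.1
    obtain ⟨η, hη, h2⟩ := hV y hy.2
    exact ⟨min ε η, lt_min hε hη, fun z hz =>
      ⟨h1 z (hz.trans_le (min_le_left _ _)), h2 z (hz.trans_le (min_le_right _ _))⟩⟩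
  isOpen_sUnion := fun s hs y hy => by
    obtain ⟨U, hU, hyU⟩ := hy
    obtain ⟨ε, hε, h1⟩ := hs U hU y hyU
    exact ⟨ε, hε, fun z hz => ⟨U, hU, h1 z hz⟩⟩

/-- `d` is a bounded metric on `G` that induces the topology of `G`. -/
structure IsCompatibleBoundedMetric {G : Type*} [τ : TopologicalSpace G] (d : G → G → ℝ) :
    Prop where
  eq_zero_iff : ∀ g h, d g h = 0 ↔ g = h
  symm : ∀ g h, d g h = d h g
  triangle : ∀ g h k, d g k ≤ d g h + d h k
  bounded : ∃ C : ℝ, ∀ g h, d g h ≤ C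
  compatible : τ = distTopology d

section Topology

variable {G X : Type*} [Group G] [TopologicalSpace G] [MeasurableSpace X] [MulAction G X]

/-- The map `Φ(f) : x ↦ f x • x` is, as an element of `Aut(X, μ)`, equal to `T`. -/
def Represents {μ : Measure X} (f : X →ₘ[μ] G) (T : Aut μ) : Prop :=
  ∃ S : mpBij μ, (QuotientGroup.mk S : Aut μ) = T ∧ ∀ᵐ x ∂μ, S.1 x = f x • x

theorem Represents.unique {μ : Measure X} {f : X →ₘ[μ] G} {T T' : Aut μ}
    (h : Represents f T) (h' : Represents f T') : T = T' := by
  obtain ⟨S, rfl, hS⟩ := h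
  obtain ⟨S', rfl, hS'⟩ := h'
  rw [aut_eq_iff]
  filter_upwards [hS, hS'] with x h1 h2
  rw [h1, h2]

variable (G) in
/-- The set `Φ⁻¹([R_G])` of all `f` in `L⁰(X, μ, G)` such that `Φ(f)` belongs to `[R_G]`. -/
def liftFullGroup (μ : Measure X) : Set (X →ₘ[μ] G) :=
  {f | ∃ T ∈ orbitFullGroup G μ, Represents f T}

variable (G) in
/-- The map `Φ : Φ⁻¹([R_G]) → [R_G]` that sends `f` to the class of `x ↦ f x • x`. -/
noncomputable def Phi (μ : Measure X) (f : liftFullGroup G μ) : orbitFullGroup G μ :=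
  ⟨f.2.choose, f.2.choose_spec.1⟩

theorem Phi_eq_iff {μ : Measure X} (f : liftFullGroup G μ) (T : orbitFullGroup G μ) :
    Phi G μ f = T ↔ Represents f.1 T.1 :=
  ⟨fun h => h ▸ f.2.choose_spec.2, fun h => Subtype.ext (f.2.choose_spec.2.unique h)⟩

/-- The topology of convergence in measure on `[R_G]`: the quotient topology under `Φ` of the
topology on `Φ⁻¹([R_G])` given by the metric `(f, g) ↦ ∫ d (f x) (g x) dμ`. -/
@[reducible]
noncomputable def convergenceInMeasure (μ : Measure X) (d : G → G → ℝ) :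
    TopologicalSpace (orbitFullGroup G μ) :=
  TopologicalSpace.coinduced (Phi G μ)
    (distTopology fun f g : liftFullGroup G μ => ∫ x, d (f.1 x) (g.1 x) ∂μ)

end Topology

end OrbitFullGroup

/-! Given `S` along the orbits of `G`, measurable uniformization yields a Borel `f : X → G` with `S
x = f x • x` almost everywhere. Matchings need countably many edges, so `H` is replaced by a
countable dense subgroup of itself. Join `y` to `h • y` whenever `h` is within `ε / 2` of `f y`. A
near-perfect measurable matching in this bipartite graph moves almost every `y`, up to small
measure, by a group element close to `f y`.

Suitability enters only through Hall's condition (`IsSuitable.measure_le_measure_neighbours`). If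
part of `S ⁻¹' C` had no edge into `C`, all nearby elements of the dense subgroup would move that
part off `C`. By suitability and continuity of the action on the measure algebra, all nearby
elements of `G` would then do so outside null sets, contradicting `S x = f x • x`.

Hall's condition gives a matching with arbitrarily small defect (`exists_matching`) by an auction:
free targets claim their cheapest neighbour and raise its price by one. A maximal total price
replaces running the auction. The matching then extends along orbits to almost all of `X`
(`exists_extension`) and is corrected on an invariant null set to a bijection
(`exists_mpBij_of_partner`). -/

namespace OrbitFullGroup

/-! ### Measurable uniformization by leftmost branches. -/

section Selection
open Filter

variable {X : Type*}

/-- The `n`-th cylinder along the leftmost branch of `q ⁻¹' {x}`. -/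
noncomputable def leftmostCylinder (q : (ℕ → ℕ) → X) (x : X) : ℕ → Set (ℕ → ℕ)
  | 0 => Set.univ
  | n + 1 => leftmostCylinder q x n ∩
      {σ | σ n = sInf {k | x ∈ q '' (leftmostCylinder q x n ∩ {σ | σ n = k})}}

/-- The leftmost branch of `q ⁻¹' {x}`. -/
noncomputable def leftmostBranch (q : (ℕ → ℕ) → X) (x : X) (n : ℕ) : ℕ :=
  sInf {k | x ∈ q '' (leftmostCylinder q x n ∩ {σ | σ n = k})}

theorem leftmostCylinder_eq (q : (ℕ → ℕ) → X) (x : X) (n : ℕ) :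
    leftmostCylinder q x n = {σ | ∀ i < n, σ i = leftmostBranch q x i} := by
  induction n with
  | zero => simp [leftmostCylinder]
  | succ n ih =>
    rw [leftmostCylinder, ih]
    ext σ
    simp only [Nat.forall_lt_succ_right, leftmostBranch, ih, Set.mem_inter_iff, Set.mem_ofPred_eq]

theorem nonempty_setOf_mem_image {q : (ℕ → ℕ) → X} {x : X} {n : ℕ} {C : Set (ℕ → ℕ)}
    (hx : x ∈ q '' C) : {k | x ∈ q '' (C ∩ {σ | σ n = k})}.Nonempty := by
  obtain ⟨σ, hσ, rfl⟩ := hx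
  exact ⟨σ n, σ, ⟨hσ, rfl⟩, rfl⟩

theorem mem_image_leftmostCylinder {q : (ℕ → ℕ) → X} (hq : Function.Surjective q) (x : X) (n : ℕ) :
    x ∈ q '' leftmostCylinder q x n := by
  induction n with
  | zero => simpa [leftmostCylinder] using hq x
  | succ n ih => exact Nat.sInf_mem (nonempty_setOf_mem_image ih)

variable [TopologicalSpace X] [PolishSpace X]

/-- Compactness of the product of the finite sets `{0, …, b i}`: a point of all the closures is a
limit of `q (σ k)` with `σ k` bounded by `b` on its first `k` coordinates. -/
theorem iInter_closure_image_subset {q : (ℕ → ℕ) → X} (hq : Continuous q) (b : ℕ → ℕ) :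
    ⋂ k : ℕ, closure (q '' {σ | ∀ i < k, σ i ≤ b i}) ⊆ q '' {σ | ∀ i, σ i ≤ b i} := by
  let := TopologicalSpace.upgradeIsCompletelyMetrizable X
  intro x hx
  have h1 : ∀ k : ℕ, ∃ σ : ℕ → ℕ, (∀ i < k, σ i ≤ b i) ∧ dist x (q σ) < 1 / ((k : ℝ) + 1) := by
    intro k
    obtain ⟨_, ⟨σ, hσ, rfl⟩, h⟩ := Metric.mem_closure_iff.1 (Set.mem_iInter.1 hx k)
      (1 / ((k : ℝ) + 1)) Nat.one_div_pos_of_nat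
    exact ⟨σ, hσ, h⟩
  choose σ hσ hd using h1
  have hlim : Tendsto (fun k => q (σ k)) atTop (𝓝 x) := by
    rw [tendsto_iff_dist_tendsto_zero]
    refine squeeze_zero (fun _ => dist_nonneg) (fun k => ?_) tendsto_one_div_add_atTop_nhds_zero_nat
    rw [dist_comm]
    exact (hd k).le
  have hK : IsCompact {σ : ℕ → ℕ | ∀ i, σ i ≤ b i} := by
    have : {σ : ℕ → ℕ | ∀ i, σ i ≤ b i} = Set.pi Set.univ fun i => Set.Iic (b i) := by
      ext σ
      simp [Pi.le_def]
    rw [this]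
    exact isCompact_univ_pi fun i => (Set.finite_Iic (b i)).isCompact
  -- Truncation at `b` puts the sequence in the compact set without changing the first `k`
  -- coordinates of `σ k`, so the limit is the same.
  obtain ⟨τ, hτ, φ, hφ, hφτ⟩ := hK.tendsto_subseq (x := fun k i => min (σ k i) (b i))
    fun k i => min_le_right _ _
  have hσφ : Tendsto (fun k => σ (φ k)) atTop (𝓝 τ) := by
    rw [tendsto_pi_nhds] at hφτ ⊢
    intro i
    refine (hφτ i).congr' ?_
    filter_upwards [eventually_gt_atTop i] with k hk
    exact min_eq_left (hσ (φ k) i (hk.trans_le (hφ.id_le k)))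
  exact ⟨τ, hτ, tendsto_nhds_unique ((hq.tendsto τ).comp hσφ) (hlim.comp hφ.tendsto_atTop)⟩

/-- Every leftmost cylinder meets the fibre over `x`; points of the fibre in these cylinders
converge to the branch, and `q` is continuous. -/
theorem apply_leftmostBranch {q : (ℕ → ℕ) → X} (hq : Continuous q) (hs : Function.Surjective q)
    (x : X) : q (leftmostBranch q x) = x := by
  choose σ hσ hσx using mem_image_leftmostCylinder hs x
  have hlim : Tendsto σ atTop (𝓝 (leftmostBranch q x)) := by
    rw [tendsto_pi_nhds]
    intro i
    refine tendsto_const_nhds.congr' ?_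
    filter_upwards [eventually_gt_atTop i] with k hk
    have := hσ k
    rw [leftmostCylinder_eq] at this
    exact (this i hk).symm
  refine tendsto_nhds_unique ((hq.tendsto _).comp hlim) ?_
  simp [Function.comp_def, hσx]

variable [MeasurableSpace X] [BorelSpace X]

/-- Capacity argument: outer measure is continuous along increasing unions of arbitrary sets, so the
coordinates can be bounded one at a time while the image keeps measure above `r`. The intersection
of the closures of these images is the required set. -/
theorem exists_measurableSet_subset_range_of_lt {μ : Measure X} [IsFiniteMeasure μ]
    {q : (ℕ → ℕ) → X} (hq : Continuous q) {r : ENNReal} (hr : r < μ (Set.range q)) :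
    ∃ M ⊆ Set.range q, MeasurableSet M ∧ r ≤ μ M := by
  have step : ∀ (k : ℕ) (C : {C : Set (ℕ → ℕ) // r < μ (q '' C)}),
      ∃ j, r < μ (q '' (C.1 ∩ {σ | σ k ≤ j})) := by
    intro k C
    have hU : q '' C.1 = ⋃ j, q '' (C.1 ∩ {σ | σ k ≤ j}) := by
      rw [← Set.image_iUnion, ← Set.inter_iUnion]
      congr 1
      refine (Set.inter_eq_left.2 fun σ _ => Set.mem_iUnion.2 ⟨σ k, le_refl (σ k)⟩).symm
    have hmono : Monotone fun j => q '' (C.1 ∩ {σ | σ k ≤ j}) := fun i j hij =>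
      Set.image_mono (Set.inter_subset_inter_right _ fun σ (hσ : σ k ≤ i) => hσ.trans hij)
    have := C.2
    rw [hU, hmono.measure_iUnion, lt_iSup_iff] at this
    exact this
  choose j hj using step
  let C : ℕ → {C : Set (ℕ → ℕ) // r < μ (q '' C)} := fun n =>
    Nat.rec ⟨Set.univ, by rwa [Set.image_univ]⟩ (fun k C => ⟨C.1 ∩ {σ | σ k ≤ j k C}, hj k C⟩) n
  let b : ℕ → ℕ := fun k => j k (C k)
  have hC : ∀ k, (C k).1 = {σ | ∀ i < k, σ i ≤ b i} := by
    intro k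
    induction k with
    | zero =>
      ext σ
      simp [C]
    | succ k ih =>
      have : (C (k + 1)).1 = (C k).1 ∩ {σ | σ k ≤ b k} := rfl
      rw [this, ih]
      ext σ
      exact Nat.forall_lt_succ_right.symm
  have hanti : Antitone fun k : ℕ => closure (q '' {σ | ∀ i < k, σ i ≤ b i}) := fun k l hkl =>
    closure_mono (Set.image_mono fun σ hσ i hi => hσ i (hi.trans_le hkl))
  refine ⟨_, (iInter_closure_image_subset hq b).trans (Set.image_subset_range _ _),
    .iInter fun k => isClosed_closure.measurableSet, ?_⟩
  rw [hanti.measure_iInter (fun k => isClosed_closure.measurableSet.nullMeasurableSet)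
    ⟨0, measure_ne_top _ _⟩]
  refine le_iInf fun k => le_trans ?_ (measure_mono subset_closure)
  rw [← hC k]
  exact (C k).2.le

theorem nullMeasurableSet_of_analyticSet (μ : Measure X) [IsFiniteMeasure μ] {A : Set X}
    (hA : AnalyticSet A) : NullMeasurableSet A μ := by
  rw [AnalyticSet] at hA
  obtain rfl | ⟨q, hq, rfl⟩ := hA
  · exact MeasurableSet.empty.nullMeasurableSet
  by_cases h0 : μ (Set.range q) = 0
  · exact .of_null h0
  obtain ⟨u, -, hu, hlim⟩ := exists_seq_strictMono_tendsto' (pos_iff_ne_zero.2 h0)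
  choose M hM hMm hMu using fun n => exists_measurableSet_subset_range_of_lt hq (hu n).2
  have hle : μ (Set.range q) ≤ μ (⋃ n, M n) :=
    le_of_tendsto' hlim fun n => (hMu n).trans (measure_mono (Set.subset_iUnion M n))
  have hm : NullMeasurableSet (⋃ n, M n) μ := (MeasurableSet.iUnion hMm).nullMeasurableSet
  exact hm.congr (ae_eq_of_subset_of_measure_ge (Set.iUnion_subset hM) hle hm (measure_ne_top _ _))

theorem nullMeasurableSet_image_cylinder (μ : Measure X) [IsFiniteMeasure μ] {q : (ℕ → ℕ) → X}
    (hq : Continuous q) (v : ℕ → ℕ) (n k : ℕ) :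
    NullMeasurableSet (q '' ({σ | ∀ i < n, σ i = v i} ∩ {σ | σ n = k})) μ := by
  refine nullMeasurableSet_of_analyticSet μ (IsOpen.analyticSet_image ?_ hq)
  have h1 : ∀ i a : ℕ, IsOpen {σ : ℕ → ℕ | σ i = a} := fun i a =>
    
    (isOpen_discrete ({a} : Set ℕ)).preimage (continuous_apply (A := fun _ => ℕ) i)
  have h2 : {σ : ℕ → ℕ | ∀ i < n, σ i = v i} = ⋂ i ∈ Set.Iio n, {σ | σ i = v i} := by
    ext σ
    simp
  rw [h2]
  exact ((Set.finite_Iio n).isOpen_biInter fun i _ => h1 i _).inter (h1 n k)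

/-- Once the first `n` values are fixed, the next one is `v n` exactly when `x` lies in the analytic
set `D (v n)` and in no earlier `D k`. -/
theorem nullMeasurableSet_leftmostBranch_prefix (μ : Measure X) [IsFiniteMeasure μ]
    {q : (ℕ → ℕ) → X} (hq : Continuous q) (hs : Function.Surjective q) (v : ℕ → ℕ) (n : ℕ) :
    NullMeasurableSet {x | ∀ i < n, leftmostBranch q x i = v i} μ := by
  induction n with
  | zero => simp
  | succ n ih =>
    let D : ℕ → Set X := fun k => q '' ({σ | ∀ i < n, σ i = v i} ∩ {σ | σ n = k})
    have : {x | ∀ i < n + 1, leftmostBranch q x i = v i} =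
        {x | ∀ i < n, leftmostBranch q x i = v i} ∩ (D (v n) \ ⋃ k ∈ Set.Iio (v n), D k) := by
      ext x
      simp only [Nat.forall_lt_succ_right, Set.mem_inter_iff, Set.mem_ofPred_eq]
      refine and_congr_right fun hx => ?_
      have hcyl : leftmostCylinder q x n = {σ | ∀ i < n, σ i = v i} := by
        rw [leftmostCylinder_eq]
        ext σ
        exact forall₂_congr fun i hi => by rw [hx i hi]
      have hne := nonempty_setOf_mem_image (n := n) (mem_image_leftmostCylinder hs x n)
      have hb : leftmostBranch q x n = sInf {k | x ∈ D k} := by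
        rw [leftmostBranch, hcyl]
      rw [hcyl] at hne
      rw [hb]
      simp only [Set.mem_sdiff, Set.mem_iUnion, Set.mem_Iio, not_exists]
      constructor
      · intro h
        refine ⟨h ▸ Nat.sInf_mem hne, fun k hk hxk => ?_⟩
        exact Nat.notMem_of_lt_sInf (h ▸ hk) hxk
      · rintro ⟨h1, h2⟩
        exact le_antisymm (Nat.sInf_le h1)
          (not_lt.1 fun hlt => h2 _ hlt (Nat.sInf_mem hne))
    rw [this]
    exact ih.inter ((nullMeasurableSet_image_cylinder μ hq v n _).diff
      (.biUnion (Set.to_countable _) fun k _ => nullMeasurableSet_image_cylinder μ hq v n k))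

theorem aemeasurable_leftmostBranch (μ : Measure X) [IsFiniteMeasure μ]
    {q : (ℕ → ℕ) → X} (hq : Continuous q) (hs : Function.Surjective q) :
    AEMeasurable (leftmostBranch q) μ := by
  refine aemeasurable_pi_lambda _ fun n => NullMeasurable.aemeasurable fun s _ => ?_
  have : (fun x => leftmostBranch q x n) ⁻¹' s =
      ⋃ w ∈ {w : Fin (n + 1) → ℕ | w (Fin.last n) ∈ s},
        {x | ∀ i < n + 1, leftmostBranch q x i = if h : i < n + 1 then w ⟨i, h⟩ else 0} := by
    ext x
    simp only [Set.mem_preimage, Set.mem_iUnion, Set.mem_ofPred_eq, exists_prop]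
    constructor
    · intro h
      exact ⟨fun i => leftmostBranch q x i, h, fun i hi => by simp [hi]⟩
    · rintro ⟨w, hw, h⟩
      have := h n n.lt_succ_self
      rw [dif_pos n.lt_succ_self] at this
      rw [this]
      exact hw
  rw [this]
  exact .biUnion (Set.to_countable _) fun w _ =>
    nullMeasurableSet_leftmostBranch_prefix μ hq hs _ _

end Selection

/-- Measurable uniformization almost everywhere. -/
theorem exists_measurable_ae_mem {X Y : Type*} [MeasurableSpace X] [StandardBorelSpace X]
    [MeasurableSpace Y] [StandardBorelSpace Y] (μ : Measure X) [IsFiniteMeasure μ]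
    {P : Set (X × Y)} (hP : MeasurableSet P) (h : ∀ x, ∃ y, (x, y) ∈ P) :
    ∃ f : X → Y, Measurable f ∧ ∀ᵐ x ∂μ, (x, f x) ∈ P := by
  let := upgradeStandardBorel X
  let := upgradeStandardBorel Y
  -- `P` is a continuous image of Baire space. The leftmost branch over `x` for the first coordinate
  -- is a point of `P` above `x`, and its second coordinate is the selected value.
  have hA := hP.analyticSet
  rw [AnalyticSet] at hA
  obtain rfl | ⟨F, hF, rfl⟩ := hA
  · have : IsEmpty X := ⟨fun x => by simpa using h x⟩
    exact ⟨isEmptyElim, measurable_of_empty _, .of_forall isEmptyElim⟩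
  have hq : Continuous fun σ => (F σ).1 := continuous_fst.comp hF
  have hs : Function.Surjective fun σ => (F σ).1 := fun x => by
    obtain ⟨y, σ, hσ⟩ := h x
    exact ⟨σ, by simp [hσ]⟩
  have hm := aemeasurable_leftmostBranch μ hq hs
  refine ⟨fun x => (F (hm.mk _ x)).2, (continuous_snd.comp hF).measurable.comp hm.measurable_mk, ?_⟩
  filter_upwards [hm.ae_eq_mk] with x hx
  have := apply_leftmostBranch hq hs x
  rw [← hx]
  exact ⟨_, Prod.ext this rfl⟩

/-! ### Priced matchings and maximal total price. -/

section Matching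

/-- A countable substitute for Zorn's lemma: step `n` comes within `1 / (n + 1)` of the supremum of
`f` above the current element, so `f` cannot grow beyond an upper bound of the resulting sequence.
-/
theorem exists_forall_ge_map_le {α : Type*} [Preorder α] [Nonempty α] {f : α → ℝ}
    (hb : BddAbove (Set.range f)) (hf : Monotone f)
    (hseq : ∀ a : ℕ → α, Monotone a → ∃ b, ∀ n, a n ≤ b) :
    ∃ a, ∀ b, a ≤ b → f b ≤ f a := by
  have hbdd : ∀ a, BddAbove (f '' Set.Ici a) := fun a => hb.mono (Set.image_subset_range _ _)
  have step : ∀ (n : ℕ) (a : α), ∃ b, a ≤ b ∧ ∀ c, a ≤ c → f c < f b + 1 / ((n : ℝ) + 1) := by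
    intro n a
    have hpos : (0 : ℝ) < 1 / ((n : ℝ) + 1) := Nat.one_div_pos_of_nat
    obtain ⟨_, ⟨b, hab, rfl⟩, hlt⟩ := exists_lt_of_lt_csSup
      (Set.Nonempty.image f ⟨a, Set.self_mem_Ici⟩)
      (sub_lt_self (sSup (f '' Set.Ici a)) hpos)
    refine ⟨b, hab, fun c hc => ?_⟩
    have := le_csSup (hbdd a) (Set.mem_image_of_mem f hc)
    linarith
  choose next hle hnext using step
  let a : ℕ → α := fun n => Nat.rec (Classical.arbitrary α) next n
  have ha : Monotone a := monotone_nat_of_le_succ fun n => hle n (a n)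
  obtain ⟨b, hb⟩ := hseq a ha
  refine ⟨b, fun c hc => le_of_forall_pos_le_add fun ε hε => ?_⟩
  obtain ⟨n, hn⟩ := exists_nat_one_div_lt hε
  have h1 := hnext n (a n) c ((hb n).trans hc)
  have h2 : f (a (n + 1)) ≤ f b := hf (hb (n + 1))
  have h3 : f (next n (a n)) = f (a (n + 1)) := rfl
  linarith

theorem exists_forall_ge_eq_of_monotone_of_le {u : ℕ → ℕ} (hu : Monotone u) {K : ℕ}
    (hK : ∀ n, u n ≤ K) : ∃ N, ∀ n, N ≤ n → u n = u N := by
  have hb : BddAbove (Set.range u) := ⟨K, by rintro _ ⟨n, rfl⟩; exact hK n⟩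
  obtain ⟨N, hN⟩ := Nat.sSup_mem (Set.range_nonempty u) hb
  exact ⟨N, fun n hn => le_antisymm (hN ▸ le_csSup hb ⟨n, rfl⟩) (hu hn)⟩

variable {X ι : Type*} [MeasurableSpace X]

/-- A partial matching of the bipartite graph with edges `(y, e i y)`, `y ∈ E i`, that matches `y`
with `e i y` if `partner y = some i`, together with bounded prices on the points `y` for which the
matching is optimal up to `1`. -/
structure PricedMatching (e : ι → X → X) (E : ι → Set X) (K : ℕ) where
  partner : X → Option ι
  price : X → ℕ
  measurableSet_partner : ∀ i, MeasurableSet {y | partner y = some i}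
  measurable_price : Measurable price
  edge : ∀ {y i}, partner y = some i → y ∈ E i
  inj : ∀ {y y' i j}, partner y = some i → partner y' = some j → e i y = e j y' → y = y'
  price_le : ∀ y, price y ≤ K
  price_eq_zero : ∀ y, partner y = none → price y = 0
  slack : ∀ {y y' i j}, partner y = some i → y' ∈ E j → e j y' = e i y → price y ≤ price y' + 1

namespace PricedMatching

variable {e : ι → X → X} {E : ι → Set X} {K : ℕ}

/-- A partner may change only where the price strictly rises. As prices are integers at most `K`,
each point changes finitely often along an increasing sequence. -/
instance : Preorder (PricedMatching e E K) where
  le a b := ∀ y, a.price y ≤ b.price y ∧ (a.price y = b.price y → a.partner y = b.partner y)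
  le_refl _ _ := ⟨le_rfl, fun _ => rfl⟩
  le_trans a b c hab hbc y := by
    refine ⟨(hab y).1.trans (hbc y).1, fun h => ?_⟩
    have h1 := (hab y).1
    have h2 := (hbc y).1
    rw [(hab y).2 (by omega), (hbc y).2 (by omega)]

instance : Nonempty (PricedMatching e E K) :=
  ⟨{  partner := fun _ => none
      price := fun _ => 0
      measurableSet_partner := by simp
      measurable_price := measurable_const
      edge := by simp
      inj := by simp
      price_le := by simp
      price_eq_zero := by simp
      slack := by simp }⟩

/-- Price and partner stabilize at each point. Each condition on a matching involves at most two
points, hence can be checked at one late stage. -/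
theorem exists_upperBound {a : ℕ → PricedMatching e E K} (ha : Monotone a) :
    ∃ b, ∀ n, a n ≤ b := by
  have hev : ∀ y, ∃ N, ∀ n, N ≤ n →
      (a n).price y = (a N).price y ∧ (a n).partner y = (a N).partner y := by
    intro y
    obtain ⟨N, hN⟩ := exists_forall_ge_eq_of_monotone_of_le
      (u := fun n => (a n).price y) (fun m n h => (ha h y).1) (fun n => (a n).price_le y)
    exact ⟨N, fun n hn => ⟨hN n hn, ((ha hn y).2 (hN n hn).symm).symm⟩⟩
  choose N hN using hev
  have hpair : ∀ y y', ∃ n, ((a n).price y = (a (N y)).price y ∧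
      (a n).partner y = (a (N y)).partner y) ∧ ((a n).price y' = (a (N y')).price y' ∧
      (a n).partner y' = (a (N y')).partner y') := fun y y' =>
    ⟨max (N y) (N y'), hN y _ (le_max_left _ _), hN y' _ (le_max_right _ _)⟩
  have hmeas : ∀ (p : PricedMatching e E K → X → Prop), (∀ n, MeasurableSet {y | p (a n) y}) →
      (∀ y n, N y ≤ n → (p (a n) y ↔ p (a (N y)) y)) →
      MeasurableSet {y | p (a (N y)) y} := by
    intro p hp hpN
    have : {y | p (a (N y)) y} = ⋃ M : ℕ, ⋂ n : ℕ, ⋂ _ : M ≤ n, {y | p (a n) y} := by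
      ext y
      simp only [Set.mem_ofPred_eq, Set.mem_iUnion, Set.mem_iInter]
      refine ⟨fun h => ⟨N y, fun n hn => (hpN y n hn).2 h⟩, fun ⟨M, hM⟩ => ?_⟩
      exact (hpN y _ (le_max_right M (N y))).1 (hM _ (le_max_left _ _))
    rw [this]
    exact .iUnion fun M => .iInter fun n => .iInter fun _ => hp n
  refine ⟨{ partner := fun y => (a (N y)).partner y
            price := fun y => (a (N y)).price y
            measurableSet_partner := fun i => ?_
            measurable_price := measurable_to_countable' fun k => ?_
            edge := fun h => (a _).edge h
            inj := fun {y y' i j} h h' hij => ?_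
            price_le := fun y => (a _).price_le y
            price_eq_zero := fun y h => (a _).price_eq_zero y h
            slack := fun {y y' i j} h h' hij => ?_ }, fun n y => ?_⟩
  · exact hmeas (fun b y => b.partner y = some i) (fun n => (a n).measurableSet_partner i)
      fun y n hn => by rw [(hN y n hn).2]
  · exact hmeas (fun b y => b.price y = k)
      (fun n => (a n).measurable_price (measurableSet_singleton k))
      fun y n hn => by rw [(hN y n hn).1]
  · obtain ⟨n, h1, h2⟩ := hpair y y'
    exact (a n).inj (h1.2.trans h) (h2.2.trans h') hij
  · obtain ⟨n, h1, h2⟩ := hpair y y'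
    rw [← h1.1, ← h2.1]
    exact (a n).slack (h1.2.trans h) h' hij
  · obtain hn | hn := le_total (N y) n
    · exact ⟨(hN y n hn).1.le, fun _ => (hN y n hn).2⟩
    · exact ha hn y

open Classical in
/-- Rematching all points of `D` along `i` while raising their prices by one. -/
noncomputable def improve (a : PricedMatching e E K) {i : ι} {D : Set X} (hD : MeasurableSet D)
    (hi : Function.Injective (e i)) (hE : D ⊆ E i) (hK : ∀ y ∈ D, a.price y < K)
    (hfree : ∀ y ∈ D, ∀ y' j, a.partner y' = some j → e j y' ≠ e i y)
    (hmin : ∀ y ∈ D, ∀ y' j, y' ∈ E j → e j y' = e i y → a.price y ≤ a.price y') :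
    PricedMatching e E K where
  partner y := if y ∈ D then some i else a.partner y
  price y := if y ∈ D then a.price y + 1 else a.price y
  measurableSet_partner j := by
    have : {y | (if y ∈ D then some i else a.partner y) = some j} =
        D.ite {_y | i = j} {y | a.partner y = some j} := by
      ext y
      by_cases hy : y ∈ D <;> simp [Set.ite, hy]
    rw [this]
    exact hD.ite (.const _) (a.measurableSet_partner j)
  measurable_price := Measurable.ite hD (a.measurable_price.add_const 1) a.measurable_price
  edge {y j} h := by
    split_ifs at h with hy
    · cases h
      exact hE hy
    · exact a.edge h
  inj {y y' j j'} h h' hjj' := by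
    split_ifs at h h' with hy hy' hy'
    · cases h
      cases h'
      exact hi hjj'
    · cases h
      exact (hfree y hy y' j' h' hjj'.symm).elim
    · cases h'
      exact (hfree y' hy' y j h hjj').elim
    · exact a.inj h h' hjj'
  price_le y := by
    split_ifs with hy
    · exact hK y hy
    · exact a.price_le y
  price_eq_zero y h := by
    split_ifs at h ⊢ with hy
    exact a.price_eq_zero y h
  slack {y y' j j'} h h' hjj' := by
    -- Raising the price of a competitor only helps; a rematched point was a cheapest neighbour of
    -- its target, so its raised price exceeds the others by at most one.
    have hle : a.price y' ≤ if y' ∈ D then a.price y' + 1 else a.price y' := by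
      split_ifs <;> omega
    refine le_trans ?_ (Nat.add_le_add_right hle 1)
    split_ifs at h ⊢ with hy
    · cases h
      exact Nat.add_le_add_right (hmin y hy y' j' h' hjj') 1
    · exact a.slack h h' hjj'

theorem le_improve (a : PricedMatching e E K) {i : ι} {D : Set X} (hD : MeasurableSet D)
    (hi : Function.Injective (e i)) (hE : D ⊆ E i) (hK : ∀ y ∈ D, a.price y < K)
    (hfree : ∀ y ∈ D, ∀ y' j, a.partner y' = some j → e j y' ≠ e i y)
    (hmin : ∀ y ∈ D, ∀ y' j, y' ∈ E j → e j y' = e i y → a.price y ≤ a.price y') :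
    a ≤ a.improve hD hi hE hK hfree hmin := by
  intro y
  by_cases hy : y ∈ D <;> simp [improve, hy]

theorem integrable_price (a : PricedMatching e E K) (μ : Measure X) [IsFiniteMeasure μ] :
    Integrable (fun y => (a.price y : ℝ)) μ := by
  refine Integrable.of_bound (C := K)
    (measurable_from_top.comp a.measurable_price).aestronglyMeasurable (.of_forall fun y => ?_)
  simpa using a.price_le y

end PricedMatching
end Matching

/-! ### Near-perfect matchings from Hall's condition. -/

section Matching
open scoped ENNReal

variable {X ι : Type*}

theorem setOf_eq_none_eq_compl (m : X → Option ι) : {y | m y = none} = {y | m y ≠ none}ᶜ := by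
  ext y
  simp

variable [MeasurableSpace X]

theorem measurableSet_ne_none [Countable ι] {m : X → Option ι}
    (hm : ∀ i, MeasurableSet {y | m y = some i}) : MeasurableSet {y | m y ≠ none} := by
  have : {y | m y ≠ none} = ⋃ i, {y | m y = some i} := by
    ext y
    simp [Option.ne_none_iff_exists']
  rw [this]
  exact .iUnion hm

theorem measurableSet_eq_none [Countable ι] {m : X → Option ι}
    (hm : ∀ i, MeasurableSet {y | m y = some i}) : MeasurableSet {y | m y = none} := by
  rw [setOf_eq_none_eq_compl]
  exact (measurableSet_ne_none hm).compl

theorem measurableSet_iUnion_image [Countable ι] {e : ι → X ≃ᵐ X} {m : X → Option ι}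
    (hm : ∀ i, MeasurableSet {y | m y = some i}) {B : Set X} (hB : MeasurableSet B) :
    MeasurableSet (⋃ i, e i '' ({y | m y = some i} ∩ B)) :=
  .iUnion fun i => (e i).measurableSet_image.2 ((hm i).inter hB)

theorem measure_iUnion_image_eq [Countable ι] {μ : Measure X} {e : ι → X ≃ᵐ X}
    (he : ∀ i, MeasurePreserving (e i) μ μ) {m : X → Option ι}
    (hm : ∀ i, MeasurableSet {y | m y = some i}) {B : Set X} (hB : MeasurableSet B)
    (hinj : ∀ y ∈ B, ∀ y' ∈ B, ∀ i j, m y = some i → m y' = some j → e i y = e j y' → y = y') :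
    μ (⋃ i, e i '' ({y | m y = some i} ∩ B)) = μ ({y | m y ≠ none} ∩ B) := by
  have hset : {y | m y ≠ none} ∩ B = ⋃ i, {y | m y = some i} ∩ B := by
    ext y
    simp [Option.ne_none_iff_exists']
  rw [hset, measure_iUnion, measure_iUnion]
  · refine tsum_congr fun i => ?_
    rw [(e i).image_eq_preimage_symm]
    exact ((he i).symm).measure_preimage ((hm i).inter hB).nullMeasurableSet
  · intro i j hij
    refine Set.disjoint_left.2 fun y hy hy' => hij ?_
    exact Option.some_injective _ (hy.1.symm.trans hy'.1)
  · exact fun i => (hm i).inter hB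
  · intro i j hij
    refine Set.disjoint_left.2 ?_
    rintro _ ⟨y, hy, rfl⟩ ⟨y', hy', h⟩
    obtain rfl := hinj y hy.2 y' hy'.2 i j hy.1 hy'.1 h.symm
    exact hij (Option.some_injective _ (hy.1.symm.trans hy'.1))
  · exact fun i => (e i).measurableSet_image.2 ((hm i).inter hB)

/-- `U i` consists of the free targets having a cheapest neighbour along `e i`, of price below `K`.
Rematching these neighbours raises the total price by `μ (U i)`, so maximality makes it null. -/
theorem PricedMatching.measure_free_neighbour_eq_zero [Countable ι] {μ : Measure X}
    [IsFiniteMeasure μ] {e : ι → X ≃ᵐ X} (he : ∀ i, MeasurePreserving (e i) μ μ)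
    {E : ι → Set X} (hE : ∀ i, MeasurableSet (E i)) {K : ℕ}
    (a : PricedMatching (fun i => e i) E K)
    (ha : ∀ b, a ≤ b → ∫ y, (b.price y : ℝ) ∂μ ≤ ∫ y, (a.price y : ℝ) ∂μ) :
    μ {x | x ∉ (⋃ i, e i '' ({y | a.partner y = some i} ∩ Set.univ)) ∧
      ∃ i, (e i).symm x ∈ E i ∧ a.price ((e i).symm x) < K} = 0 := by
  set R := ⋃ i, e i '' ({y | a.partner y = some i} ∩ Set.univ) with hR
  have hRm : MeasurableSet R := measurableSet_iUnion_image a.measurableSet_partner .univ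
  let U : ι → Set X := fun i => {x | x ∉ R ∧ (e i).symm x ∈ E i ∧ a.price ((e i).symm x) < K ∧
    ∀ j, (e j).symm x ∈ E j → a.price ((e i).symm x) ≤ a.price ((e j).symm x)}
  have hpm : ∀ i, Measurable fun x => a.price ((e i).symm x) :=
    fun i => a.measurable_price.comp (e i).symm.measurable
  have hU : ∀ i, MeasurableSet (U i) := fun i => by
    refine hRm.compl.inter (((e i).symm.measurable (hE i)).inter
      ((measurableSet_lt (hpm i) measurable_const).inter ?_))
    have : {x | ∀ j, (e j).symm x ∈ E j → a.price ((e i).symm x) ≤ a.price ((e j).symm x)} =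
        ⋂ j, ((e j).symm ⁻¹' E j)ᶜ ∪ {x | a.price ((e i).symm x) ≤ a.price ((e j).symm x)} := by
      ext x
      simp [imp_iff_not_or]
    change MeasurableSet {x | ∀ j, _ → _}
    rw [this]
    exact .iInter fun j =>
      ((e j).symm.measurable (hE j)).compl.union (measurableSet_le (hpm i) (hpm j))
  have hU0 : ∀ i, μ (U i) = 0 := by
    intro i
    have hD : MeasurableSet (e i ⁻¹' U i) := (e i).measurable (hU i)
    rw [← (he i).measure_preimage (hU i).nullMeasurableSet]
    have h1 : e i ⁻¹' U i ⊆ E i := fun y hy => by simpa using hy.2.1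
    have h2 : ∀ y ∈ e i ⁻¹' U i, a.price y < K := fun y hy => by simpa using hy.2.2.1
    have h3 : ∀ y ∈ e i ⁻¹' U i, ∀ y' j, a.partner y' = some j → e j y' ≠ e i y :=
      fun y hy y' j hj hne =>
        hy.1 (Set.mem_iUnion.2 ⟨j, y', ⟨hj, Set.mem_univ _⟩, hne⟩)
    have h4 : ∀ y ∈ e i ⁻¹' U i, ∀ y' j, y' ∈ E j → e j y' = e i y → a.price y ≤ a.price y' := by
      intro y hy y' j hj hjy
      have h' : (e j).symm (e i y) = y' := by rw [← hjy, MeasurableEquiv.symm_apply_apply]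
      have := hy.2.2.2 j
      rw [h', MeasurableEquiv.symm_apply_apply] at this
      exact this hj
    have hle := ha _ (a.le_improve hD (e i).injective h1 h2 h3 h4)
    have hprice : ∀ y, ((a.improve hD (e i).injective h1 h2 h3 h4).price y : ℝ) =
        a.price y + (e i ⁻¹' U i).indicator 1 y := by
      intro y
      by_cases hy : y ∈ e i ⁻¹' U i
      · rw [Set.indicator_of_mem hy]
        simp only [PricedMatching.improve, if_pos hy]
        simp
      · rw [Set.indicator_of_notMem hy]
        simp only [PricedMatching.improve, if_neg hy]
        simp
    simp_rw [hprice] at hle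
    rw [integral_add (a.integrable_price μ) ((show Integrable
      ((e i ⁻¹' U i).indicator 1 : X → ℝ) μ from (integrable_indicator_iff hD).2
      (integrable_const (1 : ℝ)).integrableOn)), integral_indicator_one hD] at hle
    have : μ.real (e i ⁻¹' U i) = 0 := le_antisymm (by linarith) measureReal_nonneg
    exact (measureReal_eq_zero_iff).1 this
  refine measure_mono_null (t := ⋃ i, U i) ?_ (measure_iUnion_null hU0)
  rintro x ⟨hx, i, hi, hiK⟩
  obtain ⟨j, hj, hjmin⟩ := (measure fun i => a.price ((e i).symm x)).wf.has_min
    {i | (e i).symm x ∈ E i} ⟨i, hi⟩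
  have hjmin' : ∀ k, (e k).symm x ∈ E k → a.price ((e j).symm x) ≤ a.price ((e k).symm x) :=
    fun k hk => not_lt.1 (hjmin k hk)
  exact Set.mem_iUnion.2 ⟨j, hx, hj, (hjmin' i hi).trans_lt hiK, hjmin'⟩

theorem exists_matching [Countable ι] {μ : Measure X} [IsProbabilityMeasure μ] {e : ι → X ≃ᵐ X}
    (he : ∀ i, MeasurePreserving (e i) μ μ) {E : ι → Set X} (hE : ∀ i, MeasurableSet (E i))
    (hall : ∀ C, MeasurableSet C → μ C ≤ μ {y | ∃ i, y ∈ E i ∧ e i y ∈ C})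
    {η : ℝ≥0∞} (hη : η ≠ 0) :
    ∃ m : X → Option ι, (∀ i, MeasurableSet {y | m y = some i}) ∧
      (∀ y i, m y = some i → y ∈ E i) ∧
      (∀ y y' i j, m y = some i → m y' = some j → e i y = e j y' → y = y') ∧
      μ {y | m y = none} ≤ η := by
  -- The final defect is at most `1 / K`.
  obtain ⟨K, hK⟩ := ENNReal.exists_inv_nat_lt hη
  obtain ⟨a, ha⟩ := exists_forall_ge_map_le (α := PricedMatching (fun i => e i) E K)
    (f := fun a => ∫ y, (a.price y : ℝ) ∂μ)
    ⟨K, by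
      rintro _ ⟨a, rfl⟩
      refine (integral_mono (a.integrable_price μ) (integrable_const (K : ℝ))
        fun y => Nat.cast_le.2 (a.price_le y)).trans (by simp)⟩
    (fun a b hab => integral_mono (a.integrable_price μ) (b.integrable_price μ)
      fun y => Nat.cast_le.2 (hab y).1)
    (fun _ => PricedMatching.exists_upperBound)
  have hnull := a.measure_free_neighbour_eq_zero he hE ha
  refine ⟨a.partner, a.measurableSet_partner, fun _ _ => a.edge, fun _ _ _ _ => a.inj, ?_⟩
  set R := ⋃ i, e i '' ({y | a.partner y = some i} ∩ Set.univ) with hR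
  have hRm : MeasurableSet R := measurableSet_iUnion_image a.measurableSet_partner .univ
  set W := {x | x ∉ R ∧ ∃ i, (e i).symm x ∈ E i ∧ a.price ((e i).symm x) < K} with hW
  have hNW : μ (⋃ i, e i ⁻¹' W) = 0 :=
    measure_iUnion_null fun i => (he i).quasiMeasurePreserving.preimage_null hnull
  have hpm : ∀ j : ℕ, MeasurableSet {y | j ≤ a.price y} :=
    fun j => measurableSet_le measurable_const a.measurable_price
  have hRnone : μ {y | a.partner y = none} = μ Rᶜ := by
    have h1 := measure_iUnion_image_eq he a.measurableSet_partner .univ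
      fun _ _ _ _ _ _ => a.inj
    rw [setOf_eq_none_eq_compl, prob_compl_eq_one_sub hRm, hR, h1, Set.inter_univ,
      prob_compl_eq_one_sub (measurableSet_ne_none a.measurableSet_partner)]
  -- Apply Hall's condition to the free targets together with those held at price at least `j + 1`.
  -- Up to a null set their neighbours cost at least `j`: those of free targets cost `K` by
  -- maximality, the others satisfy `slack`.
  have hstep : ∀ j < K, μ Rᶜ + μ {y | j + 1 ≤ a.price y} ≤ μ {y | j ≤ a.price y} := by
    intro j hj
    set M := ⋃ i, e i '' ({y | a.partner y = some i} ∩ {y | j + 1 ≤ a.price y}) with hM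
    have hMm : MeasurableSet M := measurableSet_iUnion_image a.measurableSet_partner (hpm _)
    have hMμ : μ M = μ {y | j + 1 ≤ a.price y} := by
      rw [hM, measure_iUnion_image_eq he a.measurableSet_partner (hpm _)
        fun _ _ _ _ _ _ => a.inj, Set.inter_eq_right.2]
      intro y hy hnone
      have h0 := a.price_eq_zero y hnone
      have h1 : j + 1 ≤ a.price y := hy
      omega
    have hMR : M ⊆ R :=
      Set.iUnion_mono fun i => Set.image_mono (Set.inter_subset_inter_right _ (Set.subset_univ _))
    rw [← hMμ, ← measure_union ((Set.disjoint_compl_left_iff_subset).2 hMR) hMm]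
    refine (hall _ (hRm.compl.union hMm)).trans ?_
    rw [← add_zero (μ {y | j ≤ a.price y}), ← hNW]
    refine (measure_mono ?_).trans (measure_union_le _ _)
    rintro y ⟨i, hyi, hy | hy⟩
    · by_cases hyK : a.price y < K
      · refine Or.inr (Set.mem_iUnion.2 ⟨i, hy, i, ?_⟩)
        simpa using ⟨hyi, hyK⟩
      · exact Or.inl (hj.le.trans (not_lt.1 hyK))
    · obtain ⟨i', y', ⟨hy', hp⟩, heq⟩ := Set.mem_iUnion.1 hy
      have := a.slack hy' hyi heq.symm
      have hp' : j + 1 ≤ a.price y' := hp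
      exact Or.inl (by change j ≤ a.price y; omega)
  -- Telescoping down from level `K`: each level gains one copy of the defect.
  have hsum : ∀ n ≤ K, (n : ℝ≥0∞) * μ Rᶜ ≤ μ {y | K - n ≤ a.price y} := by
    intro n
    induction n with
    | zero => simp
    | succ n ih =>
      intro hn
      refine le_trans ?_ (hstep (K - (n + 1)) (by omega))
      rw [show K - (n + 1) + 1 = K - n by omega, Nat.cast_add_one, add_mul, one_mul, add_comm]
      exact add_le_add_right (ih (by omega)) _
  have hK1 : (K : ℝ≥0∞) * μ Rᶜ ≤ 1 := (hsum K le_rfl).trans prob_le_one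
  rw [hRnone]
  refine le_trans ?_ hK.le
  rwa [ENNReal.le_inv_iff_mul_le, mul_comm]

end Matching

/-! ### From a partial matching to an element of the full group. -/

section Extension

variable {X Γ : Type*} [MeasurableSpace X] [Group Γ] [Countable Γ] [MulAction Γ X]
  [MeasurableConstSMul Γ X]

/-- A measurable partial injection that moves points along the orbits of a countable group extends
to one that is defined almost everywhere. -/
theorem exists_extension {μ : Measure X} [IsFiniteMeasure μ] [SMulInvariantMeasure Γ X μ]
    {m : X → Option Γ} (hm : ∀ γ, MeasurableSet {y | m y = some γ})
    (hinj : ∀ y y' γ γ', m y = some γ → m y' = some γ' → γ • y = γ' • y' → y = y') :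
    ∃ k : X → Option Γ, (∀ γ, MeasurableSet {y | k y = some γ}) ∧
      (∀ y γ, m y = some γ → k y = some γ) ∧
      (∀ y y' γ γ', k y = some γ → k y' = some γ' → γ • y = γ' • y' → y = y') ∧
      μ {y | k y = none} = 0 := by
  classical
  let e : Γ → X ≃ᵐ X := MeasurableEquiv.smul
  have he : ∀ γ, MeasurePreserving (e γ) μ μ := fun γ => measurePreserving_smul γ μ
  -- With maximal price `1` already charged on matched points, nothing above `a₀` can rematch them:
  -- it extends `m`.
  let a₀ : PricedMatching (fun γ => e γ) (fun _ => Set.univ) 1 :=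
    { partner := m
      price := fun y => if m y = none then 0 else 1
      measurableSet_partner := hm
      measurable_price :=
        Measurable.ite (measurableSet_eq_none hm) measurable_const measurable_const
      edge := fun _ => Set.mem_univ _
      inj := fun {y y' γ γ'} => hinj y y' γ γ'
      price_le := fun y => by split_ifs <;> omega
      price_eq_zero := fun y h => if_pos h
      slack := fun _ _ _ => by split_ifs <;> omega }
  have : Nonempty (Set.Ici a₀) := ⟨⟨a₀, le_refl a₀⟩⟩
  obtain ⟨⟨a, ha₀⟩, ha⟩ := exists_forall_ge_map_le (α := Set.Ici a₀)
    (f := fun a => ∫ y, (a.1.price y : ℝ) ∂μ)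
    ⟨∫ _, ((1 : ℕ) : ℝ) ∂μ, by
      rintro _ ⟨a, rfl⟩
      exact integral_mono (a.1.integrable_price μ) (integrable_const _)
        fun y => Nat.cast_le.2 (a.1.price_le y)⟩
    (fun a b hab => integral_mono (a.1.integrable_price μ) (b.1.integrable_price μ)
      fun y => Nat.cast_le.2 (hab y).1)
    (fun u hu => by
      obtain ⟨b, hb⟩ := PricedMatching.exists_upperBound (a := fun n => (u n).1)
        fun _ _ h => hu h
      exact ⟨⟨b, (u 0).2.trans (hb 0)⟩, hb⟩)
  have hnull := a.measure_free_neighbour_eq_zero he (fun _ => .univ)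
    (fun b hb => ha ⟨b, ha₀.trans hb⟩ hb)
  set R := ⋃ γ, e γ '' ({y | a.partner y = some γ} ∩ Set.univ) with hR
  have hRm : MeasurableSet R := measurableSet_iUnion_image a.measurableSet_partner .univ
  set W := {x | x ∉ R ∧ ∃ γ, (e γ).symm x ∈ Set.univ ∧ a.price ((e γ).symm x) < 1} with hW
  -- The saturation of the free targets. Almost every point of `Y` is matched, since an unmatched
  -- one has price `0` and a free target in its orbit.
  let Y : Set X := ⋃ γ : Γ, e γ ⁻¹' Rᶜ
  have hY : MeasurableSet Y := .iUnion fun γ => (e γ).measurable hRm.compl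
  have hYinv : ∀ (γ : Γ) (x : X), x ∈ Y → γ • x ∈ Y := by
    intro γ x hx
    obtain ⟨γ', h⟩ := Set.mem_iUnion.1 hx
    refine Set.mem_iUnion.2 ⟨γ' * γ⁻¹, ?_⟩
    change (γ' * γ⁻¹) • γ • x ∈ Rᶜ
    rwa [mul_smul, inv_smul_smul]
  have hYnone : μ (Y ∩ {y | a.partner y = none}) = 0 := by
    refine measure_mono_null (t := ⋃ γ : Γ, e γ ⁻¹' W) ?_
      (measure_iUnion_null fun γ => (he γ).quasiMeasurePreserving.preimage_null hnull)
    rintro y ⟨hy, hnone⟩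
    obtain ⟨γ, h⟩ := Set.mem_iUnion.1 hy
    refine Set.mem_iUnion.2 ⟨γ, h, γ, Set.mem_univ _, ?_⟩
    rw [MeasurableEquiv.symm_apply_apply, a.price_eq_zero y hnone]
    exact one_pos
  -- The matching carries almost all of `Y` injectively into `Y ∩ R`, preserving measure; as `μ` is
  -- finite, `Y \ R` is null.
  have hcompl : μ Rᶜ = 0 := by
    have h1 := measure_iUnion_image_eq he a.measurableSet_partner hY
      fun _ _ _ _ _ _ => a.inj
    have h2 : μ ({y | a.partner y ≠ none} ∩ Y) = μ Y := by
      refine le_antisymm (measure_mono Set.inter_subset_right) ?_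
      rw [← add_zero (μ (_ ∩ _)), ← hYnone]
      refine (measure_mono fun y hy => ?_).trans (measure_union_le _ _)
      by_cases h : a.partner y = none
      · exact Or.inr ⟨hy, h⟩
      · exact Or.inl ⟨h, hy⟩
    have h3 : (⋃ γ, e γ '' ({y | a.partner y = some γ} ∩ Y)) ⊆ Y ∩ R := by
      refine Set.iUnion_subset fun γ => ?_
      rintro _ ⟨y, ⟨hy, hyY⟩, rfl⟩
      exact ⟨hYinv γ y hyY, Set.mem_iUnion.2 ⟨γ, y, ⟨hy, Set.mem_univ _⟩, rfl⟩⟩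
    have h4 : μ Y ≤ μ (Y ∩ R) := by
      rw [← h2, ← h1]
      exact measure_mono h3
    have h5 := measure_inter_add_sdiff Y hRm (μ := μ)
    have h6 : μ (Y \ R) = 0 := by
      have hle : μ (Y ∩ R) + μ (Y \ R) ≤ μ (Y ∩ R) + 0 := by rwa [h5, add_zero]
      exact nonpos_iff_eq_zero.1 ((ENNReal.add_le_add_iff_left (measure_ne_top _ _)).1 hle)
    refine measure_mono_null (t := Y \ R) (fun x hx => ⟨?_, hx⟩) h6
    refine Set.mem_iUnion.2 ⟨1, ?_⟩
    change (1 : Γ) • x ∈ Rᶜ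
    rwa [one_smul]
  refine ⟨a.partner, a.measurableSet_partner, fun y γ h => ?_, fun _ _ _ _ => a.inj, ?_⟩
  · rw [← h]
    refine ((ha₀ y).2 (le_antisymm (ha₀ y).1 ?_)).symm
    have : a₀.price y = 1 := if_neg (by simp [h])
    rw [this]
    exact a.price_le y
  · have h1 := measure_iUnion_image_eq he a.measurableSet_partner .univ
      fun _ _ _ _ _ _ => a.inj
    rw [setOf_eq_none_eq_compl, measure_compl (measurableSet_ne_none a.measurableSet_partner)
      (measure_ne_top _ _), ← Set.inter_univ {y | a.partner y ≠ none}, ← h1, ← hR,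
      ← measure_compl hRm (measure_ne_top _ _), hcompl]

/-- A measurable injection that is defined almost everywhere and moves points along the orbits of a
countable group agrees almost everywhere with an element of the orbit full group. -/
theorem exists_mpBij_of_partner [StandardBorelSpace X] {μ : Measure X} [IsFiniteMeasure μ]
    [SMulInvariantMeasure Γ X μ] {k : X → Option Γ} (hk : ∀ γ, MeasurableSet {y | k y = some γ})
    (hinj : ∀ y y' γ γ', k y = some γ → k y' = some γ' → γ • y = γ' • y' → y = y')
    (hnone : μ {y | k y = none} = 0) :
    ∃ S : mpBij μ, (∀ x, S.1 x ∈ MulAction.orbit Γ x) ∧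
      ∀ᵐ x ∂μ, S.1 x = (k x).getD 1 • x := by
  classical
  let e : Γ → X ≃ᵐ X := MeasurableEquiv.smul
  have he : ∀ γ, MeasurePreserving (e γ) μ μ := fun γ => measurePreserving_smul γ μ
  let R := ⋃ γ, e γ '' ({y | k y = some γ} ∩ Set.univ)
  have hRm : MeasurableSet R := measurableSet_iUnion_image hk .univ
  have hnm : MeasurableSet {y | k y = none} := measurableSet_eq_none hk
  have hR0 : μ Rᶜ = 0 := by
    rw [measure_compl hRm (measure_ne_top _ _), measure_iUnion_image_eq he hk .univ
      fun y _ y' _ => hinj y y', Set.inter_univ,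
      ← measure_compl (measurableSet_ne_none hk) (measure_ne_top _ _), 
      ← setOf_eq_none_eq_compl, hnone]
  -- Saturating the bad null set makes it invariant, so the identity on it and the matching off it
  -- combine into a bijection of all of `X`.
  let N : Set X := ⋃ γ : Γ, e γ ⁻¹' ({y | k y = none} ∪ Rᶜ)
  have hN : MeasurableSet N := .iUnion fun γ => (e γ).measurable (hnm.union hRm.compl)
  have hN0 : μ N = 0 := measure_iUnion_null fun γ =>
    (he γ).quasiMeasurePreserving.preimage_null (measure_union_null hnone hR0)
  have hNinv : ∀ (γ : Γ) (x : X), γ • x ∈ N ↔ x ∈ N := by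
    have h : ∀ (γ : Γ) (x : X), x ∈ N → γ • x ∈ N := by
      intro γ x hx
      obtain ⟨γ', h⟩ := Set.mem_iUnion.1 hx
      refine Set.mem_iUnion.2 ⟨γ' * γ⁻¹, ?_⟩
      change (γ' * γ⁻¹) • γ • x ∈ {y | k y = none} ∪ Rᶜ
      rwa [mul_smul, inv_smul_smul]
    exact fun γ x => ⟨fun hx => by simpa using h γ⁻¹ _ hx, h γ x⟩
  have hN1 : ∀ x ∉ N, (∃ γ, k x = some γ) ∧ x ∈ R := by
    intro x hx
    have h1 : x ∉ {y | k y = none} ∪ Rᶜ := fun h =>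
      hx (Set.mem_iUnion.2 ⟨1, by
      change (1 : Γ) • x ∈ {y | k y = none} ∪ Rᶜ
      rwa [one_smul]⟩)
    exact ⟨Option.ne_none_iff_exists'.1 fun h => h1 (Or.inl h), by_contra fun h => h1 (Or.inr h)⟩
  let T : X → X := fun x => if x ∈ N then x else (k x).getD 1 • x
  have hTN : ∀ x ∈ N, T x = x := fun x hx => if_pos hx
  have hTk : ∀ x ∉ N, ∀ γ, k x = some γ → T x = γ • x := fun x hx γ h => by
    simp [T, hx, h]
  have hTmem : ∀ x, T x ∈ N ↔ x ∈ N := by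
    intro x
    by_cases hx : x ∈ N
    · rw [hTN x hx]
    · obtain ⟨γ, h⟩ := (hN1 x hx).1
      rw [hTk x hx γ h, hNinv]
  have hTm : Measurable T := by
    refine Measurable.ite hN measurable_id ?_
    intro B hB
    have : (fun x => (k x).getD 1 • x) ⁻¹' B = ({y | k y = none} ∩ B) ∪
        ⋃ γ, {y | k y = some γ} ∩ e γ ⁻¹' B := by
      ext x
      cases h : k x with
      | none => simp [h]
      | some γ => simp [h, e]
    rw [this]
    exact (hnm.inter hB).union (.iUnion fun γ => (hk γ).inter ((e γ).measurable hB))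
  have hTinj : Function.Injective T := by
    intro x y hxy
    by_cases hx : x ∈ N
    · have hy : y ∈ N := by rwa [← hTmem, ← hxy, hTmem]
      rwa [hTN x hx, hTN y hy] at hxy
    · have hy : y ∉ N := by rwa [← hTmem, ← hxy, hTmem]
      obtain ⟨γ, h⟩ := (hN1 x hx).1
      obtain ⟨γ', h'⟩ := (hN1 y hy).1
      rw [hTk x hx γ h, hTk y hy γ' h'] at hxy
      exact hinj x y γ γ' h h' hxy
  have hTsurj : Function.Surjective T := by
    intro x
    by_cases hx : x ∈ N
    · exact ⟨x, hTN x hx⟩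
    · obtain ⟨γ, y, ⟨hy, -⟩, rfl⟩ := Set.mem_iUnion.1 (hN1 x hx).2
      exact ⟨y, hTk y (fun h => hx ((hNinv γ y).2 h)) γ hy⟩
  have hTmp : MeasurePreserving T μ μ := by
    refine ⟨hTm, Measure.ext fun B hB => ?_⟩
    rw [Measure.map_apply hTm hB]
    have hset : (⋃ γ, e γ '' ({y | k y = some γ} ∩ (T ⁻¹' B \ N))) = B \ N := by
      ext x
      simp only [Set.mem_iUnion, Set.mem_image]
      constructor
      · rintro ⟨γ, y, ⟨hy, hyB, hyN⟩, rfl⟩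
        change γ • y ∈ B \ N
        rw [← hTk y hyN γ hy]
        exact ⟨hyB, fun h => hyN ((hTmem y).1 h)⟩
      · rintro ⟨hxB, hxN⟩
        obtain ⟨y, rfl⟩ := hTsurj x
        have hy : y ∉ N := fun h => hxN ((hTmem y).2 h)
        obtain ⟨γ, h⟩ := (hN1 y hy).1
        exact ⟨γ, y, ⟨h, hxB, hy⟩, (hTk y hy γ h).symm⟩
    have h1 := measure_iUnion_image_eq he hk ((hTm hB).diff hN) fun y _ y' _ => hinj y y'
    rw [hset, Set.inter_eq_right.2, measure_sdiff_null hN0, measure_sdiff_null hN0] at h1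
    · exact h1.symm
    · intro y hy hynone
      obtain ⟨γ, h⟩ := (hN1 y hy.2).1
      exact Option.some_ne_none γ (h.symm.trans hynone)
  let S : Equiv.Perm X := Equiv.ofBijective T ⟨hTinj, hTsurj⟩
  have hSm : Measurable S.symm := by
    intro B hB
    rw [← Equiv.image_eq_preimage_symm]
    exact (hTm.measurableEmbedding hTinj).measurableSet_image.2 hB
  refine ⟨⟨S, hTmp, hSm⟩, fun x => ?_, ?_⟩
  · change T x ∈ _
    by_cases hx : x ∈ N
    · rw [hTN x hx]
      exact MulAction.mem_orbit_self x
    · obtain ⟨γ, h⟩ := (hN1 x hx).1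
      rw [hTk x hx γ h]
      exact MulAction.mem_orbit x γ
  · filter_upwards [measure_eq_zero_iff_ae_notMem.1 hN0] with x hx
    exact if_neg hx

end Extension

/-! ### Continuity on the measure algebra and suitability. -/

section Continuity
open Filter
open scoped ENNReal symmDiff

/-- Pettis' lemma. -/
theorem eventually_exists_mem_mul_mem {G : Type*} [Group G] [TopologicalSpace G]
    [IsTopologicalGroup G] [BaireSpace G] [MeasurableSpace G] [BorelSpace G] {A : Set G}
    (hA : MeasurableSet A) (hA' : ¬ IsMeagre A) : ∀ᶠ g in 𝓝 (1 : G), ∃ a ∈ A, a * g ∈ A := by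
  obtain ⟨U, hU, hAU⟩ := hA.residualEq_isOpen
  have hne : U.Nonempty := by
    rw [Set.nonempty_iff_ne_empty]
    rintro rfl
    refine hA' ?_
    rw [IsMeagre]
    filter_upwards [hAU.mem_iff] with x hx
    simpa using hx
  obtain ⟨u, hu⟩ := hne
  have hnhds : ∀ᶠ g in 𝓝 (1 : G), u * g ∈ U :=
    (continuous_const_mul u).continuousAt.eventually_mem (hU.mem_nhds (by simpa using hu))
  filter_upwards [hnhds] with g hg
  have h1 : ∀ᶠ x in residual G, (x * g ∈ A ↔ x * g ∈ U) :=
    (tendsto_residual_of_isOpenMap (continuous_mul_const g)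
      (isOpenMap_mul_right g)).eventually hAU.mem_iff
  -- This open set contains `u`, so it meets the comeagre set where `A` and `U` agree at both `x`
  -- and `x * g`.
  have hopen : IsOpen (U ∩ (fun x => x * g) ⁻¹' U) :=
    hU.inter (hU.preimage (continuous_mul_const g))
  obtain ⟨x, ⟨hx1, hx2⟩, hx3, hx4⟩ :=
    (dense_of_mem_residual (hAU.mem_iff.and h1)).inter_open_nonempty _ hopen ⟨u, hu, hg⟩
  exact ⟨x, hx3.2 hx1, hx4.2 hx2⟩

theorem measurable_measure_smul_symmDiff {G X : Type*} [Group G] [TopologicalSpace G]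
    [IsTopologicalGroup G] [MeasurableSpace G] [BorelSpace G] [MeasurableSpace X]
    [MulAction G X] [MeasurableSMul₂ G X] (μ : Measure X) [SFinite μ] {A t : Set X}
    (hA : MeasurableSet A) (ht : MeasurableSet t) : Measurable fun g : G => μ ((g • A) ∆ t) := by
  have h1 : MeasurableSet {p : G × X | p.1⁻¹ • p.2 ∈ A} :=
    (measurable_fst.inv.smul measurable_snd) hA
  have h2 : MeasurableSet ({p : G × X | p.1⁻¹ • p.2 ∈ A} ∆ (Prod.snd ⁻¹' t)) :=
    h1.symmDiff (measurable_snd ht)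
  convert measurable_measure_prodMk_left (ν := μ) h2 using 3 with g
  ext x
  simp [Set.mem_symmDiff, Set.mem_smul_set_iff_inv_smul_mem]

variable {G : Type*} [Group G] [TopologicalSpace G] [IsTopologicalGroup G]
  [PolishSpace G] [MeasurableSpace G] [BorelSpace G]
  {X : Type*} [MeasurableSpace X] [StandardBorelSpace X]
  [MulAction G X] [MeasurableSMul₂ G X]

/-- The measure algebra is separable, so countably many sets `E t` cover `G` and one is nonmeagre.
Pettis' lemma gives `a` and `a * g` in it for every `g` near `1`, and invariance turns closeness of
`(a * g) • A` and `a • A` into the claim. -/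
theorem eventually_measure_smul_symmDiff_lt (μ : Measure X) [IsFiniteMeasure μ]
    [SMulInvariantMeasure G X μ] {A : Set X} (hA : MeasurableSet A) {ε : ℝ≥0∞} (hε : ε ≠ 0) :
    ∀ᶠ g in 𝓝 (1 : G), μ ((g • A) ∆ A) < ε := by
  obtain ⟨δ, hδ, hδε⟩ : ∃ δ : ℝ, 0 < δ ∧ ENNReal.ofReal δ + ENNReal.ofReal δ ≤ ε := by
    obtain ⟨δ, hδ, hδε⟩ := ENNReal.lt_iff_exists_nnreal_btwn.1 (pos_iff_ne_zero.2 hε)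
    have hδ' : 0 < δ := by simpa using hδ
    refine ⟨δ / 2, by positivity, ?_⟩
    rw [← ENNReal.ofReal_add (by positivity) (by positivity), add_halves,
      ENNReal.ofReal_coe_nnreal]
    exact hδε.le
  obtain ⟨𝒜, h𝒜, hdense⟩ := (inferInstance : IsSeparable μ).exists_countable_measureDense
  let E : Set X → Set G := fun t => {g | μ ((g • A) ∆ t) < ENNReal.ofReal δ}
  have hcover : ∀ g : G, ∃ t ∈ 𝒜, g ∈ E t := fun g =>
    hdense.approx _ (hA.const_smul g) (measure_ne_top _ _) δ hδ
  obtain ⟨t, ht, hnm⟩ : ∃ t ∈ 𝒜, ¬ IsMeagre (E t) := by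
    by_contra! hcon
    have h0 : IsMeagre (⋃ t ∈ 𝒜, E t) := isMeagre_biUnion h𝒜 hcon
    have huniv : (⋃ t ∈ 𝒜, E t) = Set.univ := by
      ext g
      simpa using hcover g
    rw [huniv, IsMeagre, Set.compl_univ] at h0
    simpa using (dense_of_mem_residual h0).nonempty
  have hE : MeasurableSet (E t) :=
    measurableSet_lt (measurable_measure_smul_symmDiff μ hA (hdense.measurable t ht))
      measurable_const
  filter_upwards [eventually_exists_mem_mul_mem hE hnm] with g ⟨a, ha, hag⟩
  have heq : μ ((g • A) ∆ A) = μ (((a * g) • A) ∆ (a • A)) := by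
    rw [mul_smul, ← Set.smul_set_symmDiff, measure_smul]
  rw [heq]
  refine (measure_symmDiff_le _ t _).trans_lt (lt_of_lt_of_le (ENNReal.add_lt_add hag ?_) hδε)
  rw [symmDiff_comm]
  exact ha

/-- Positivity of `μ ((g • A) ∩ B)` is an open condition on `g`, so a dense set witnesses it. -/
theorem exists_mem_measure_smul_inter_pos {μ : Measure X} [IsFiniteMeasure μ]
    [SMulInvariantMeasure G X μ] {H : Set G} (hH : Dense H) {V : Set G} (hV : IsOpen V) {g : G}
    (hg : g ∈ V) {A B : Set X} (hA : MeasurableSet A) (hpos : 0 < μ ((g • A) ∩ B)) :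
    ∃ h ∈ H, h ∈ V ∧ 0 < μ ((h • A) ∩ B) := by
  have h1 := eventually_measure_smul_symmDiff_lt (G := G) μ hA hpos.ne'
  have h2 : Tendsto (fun h : G => g⁻¹ * h) (𝓝 g) (𝓝 1) := by
    simpa using (continuous_const_mul g⁻¹).tendsto g
  have h3 : ∀ᶠ h in 𝓝 g, h ∈ V ∧ μ (((g⁻¹ * h) • A) ∆ A) < μ ((g • A) ∩ B) :=
    (hV.eventually_mem hg).and (h2.eventually h1)
  obtain ⟨W, hW, hWo, hgW⟩ := eventually_nhds_iff.1 h3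
  obtain ⟨h, hhW, hhH⟩ := hH.inter_open_nonempty W hWo ⟨g, hgW⟩
  obtain ⟨hhV, hlt⟩ := hW h hhW
  refine ⟨h, hhH, hhV, pos_iff_ne_zero.2 fun h0 => hlt.not_ge ?_⟩
  rw [← measure_smul (μ := μ) g (((g⁻¹ * h) • A) ∆ A), Set.smul_set_symmDiff, ← mul_smul,
    mul_inv_cancel_left]
  refine (measure_mono (t := ((h • A) ∩ B) ∪ (h • A) ∆ (g • A)) fun x hx => ?_).trans
    ((measure_union_le _ _).trans (by rw [h0, zero_add]))
  by_cases hxh : x ∈ h • A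
  · exact Or.inl ⟨hxh, hx.2⟩
  · exact Or.inr (Or.inr ⟨hx.1, hxh⟩)

/-- For a suitable action, if `g • A` essentially avoids `B` for all `g ∈ V ∩ H`, then `V • A`
avoids `B` after discarding null sets. -/
theorem IsSuitable.exists_smul_inter_eq_empty {μ : Measure X} [IsFiniteMeasure μ]
    [SMulInvariantMeasure G X μ] (hsuit : IsSuitable G μ) {H : Set G} (hH : Dense H) {V : Set G}
    (hV : IsOpen V) {A B : Set X} (hA : MeasurableSet A) (hB : MeasurableSet B)
    (hzero : ∀ h ∈ H, h ∈ V → μ ((h • A) ∩ B) = 0) :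
    ∃ A' ⊆ A, ∃ B' ⊆ B, μ (A \ A') = 0 ∧ μ (B \ B') = 0 ∧ (V • A') ∩ B' = ∅ := by
  by_cases hA0 : μ A = 0
  · exact ⟨∅, Set.empty_subset _, B, subset_rfl, by simpa using hA0, by simp, by simp⟩
  by_cases hB0 : μ B = 0
  · exact ⟨A, subset_rfl, ∅, Set.empty_subset _, by simp, by simpa using hB0, by simp⟩
  have hloc : ∀ g : V, ∃ (W : Set G) (A' B' : Set X), IsOpen W ∧ g.1 ∈ W ∧ A' ⊆ A ∧ B' ⊆ B ∧
      μ (A \ A') = 0 ∧ μ (B \ B') = 0 ∧ (W • A') ∩ B' = ∅ := by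
    rintro ⟨g, hg⟩
    obtain h | ⟨A', B', O, -, -, hA', hB', hA0', hB0', hO, h1, hempty⟩ :=
      hsuit (g • A) B (hA.const_smul g) hB (by rw [measure_smul]; exact pos_iff_ne_zero.2 hA0)
        (pos_iff_ne_zero.2 hB0)
    -- The first alternative, used with `k` so close to `1` that `k⁻¹ * g ∈ V`, would give positive
    -- measure for `k⁻¹ * g`, hence for some element of `H` in `V`.
    · exfalso
      obtain ⟨k, hk, hpos⟩ := h ((fun k => k⁻¹ * g) ⁻¹' V)
        (hV.preimage (continuous_inv.mul continuous_const)) (by simpa using hg)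
      have hpos' : 0 < μ (((k⁻¹ * g) • A) ∩ B) := by
        rw [← measure_smul (μ := μ) k, Set.smul_set_inter, ← mul_smul, mul_inv_cancel_left]
        exact hpos
      obtain ⟨h, hhH, hhV, hh⟩ := exists_mem_measure_smul_inter_pos hH hV hk hA hpos'
      exact hh.ne' (hzero h hhH hhV)
    · refine ⟨(fun k => k * g⁻¹) ⁻¹' O, g⁻¹ • A', B', hO.preimage (continuous_mul_const _),
        by simpa using h1, ?_, hB', ?_, hB0', ?_⟩
      · rwa [Set.smul_set_subset_iff_subset_inv_smul_set, inv_inv]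
      · rw [← measure_smul (μ := μ) g, Set.smul_set_sdiff, smul_inv_smul]
        exact hA0'
      · rw [Set.eq_empty_iff_forall_notMem] at hempty ⊢
        rintro x ⟨⟨w, hw, y, hy, rfl⟩, hx⟩
        refine hempty (w • y) ⟨⟨w * g⁻¹, hw, g • y, ?_, by simp [mul_smul]⟩, hx⟩
        exact Set.mem_inv_smul_set_iff.1 hy
  choose W A' B' hW hgW hA' hB' hA0' hB0' hempty using hloc
  -- By the Lindelöf property countably many neighbourhoods suffice, so only null sets are
  -- discarded.
  obtain ⟨T, hT, hTW⟩ := TopologicalSpace.isOpen_iUnion_countable W hW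
  refine ⟨A ∩ ⋂ g ∈ T, A' g, Set.inter_subset_left, B ∩ ⋂ g ∈ T, B' g, Set.inter_subset_left,
    ?_, ?_, ?_⟩
  · simp_rw [Set.sdiff_self_inter, Set.sdiff_iInter]
    exact (measure_biUnion_null_iff hT).2 fun g _ => hA0' g
  · simp_rw [Set.sdiff_self_inter, Set.sdiff_iInter]
    exact (measure_biUnion_null_iff hT).2 fun g _ => hB0' g
  · rw [Set.eq_empty_iff_forall_notMem]
    rintro x ⟨⟨v, hv, y, hy, rfl⟩, hx⟩
    have hvW : v ∈ ⋃ g ∈ T, W g := hTW ▸ Set.mem_iUnion.2 ⟨⟨v, hv⟩, hgW ⟨v, hv⟩⟩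
    obtain ⟨g, hgT, hvg⟩ := Set.mem_iUnion₂.1 hvW
    refine Set.eq_empty_iff_forall_notMem.1 (hempty g) (v • y) ⟨⟨v, hvg, y, ?_, rfl⟩, ?_⟩
    · exact Set.mem_iInter₂.1 hy.2 g hgT
    · exact Set.mem_iInter₂.1 hx.2 g hgT

end Continuity

/-! ### Hall's condition from suitability. -/

section Hall

variable {G : Type*} [Group G] [TopologicalSpace G] [IsTopologicalGroup G]
  [PolishSpace G] [MeasurableSpace G] [BorelSpace G]
  {X : Type*} [MeasurableSpace X] [StandardBorelSpace X]
  [MulAction G X] [MeasurableSMul₂ G X]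

/-- Hall's condition for the graph with edges `(y, h • y)`, `y ∈ E h`, where `E h` contains all
points `y` at which `h` is close to `f y`. -/
theorem IsSuitable.measure_le_measure_neighbours {μ : Measure X} [IsFiniteMeasure μ]
    [SMulInvariantMeasure G X μ] (hsuit : IsSuitable G μ) {H : Subgroup G} [Countable H]
    (hH : Dense (H : Set G)) {S : X → X} (hS : MeasurePreserving S μ μ) {f : X → G}
    (hf : Measurable f) (hSf : ∀ᵐ x ∂μ, S x = f x • x) {ι : Type*} [Countable ι] {V : ι → Set G}
    (hV : ∀ n, IsOpen (V n)) (hcover : ∀ g, ∃ n, g ∈ V n) {E : H → Set X}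
    (hE : ∀ h, MeasurableSet (E h)) (hVE : ∀ n (h : H), h.1 ∈ V n → f ⁻¹' V n ⊆ E h)
    {C : Set X} (hC : MeasurableSet C) :
    μ C ≤ μ {y | ∃ h, y ∈ E h ∧ h • y ∈ C} := by
  set N := {y | ∃ h, y ∈ E h ∧ h • y ∈ C} with hN
  have hNm : MeasurableSet N := by
    have : N = ⋃ h, E h ∩ (fun y => h.1 • y) ⁻¹' C := by
      ext y
      simp only [hN, Set.mem_iUnion]
      rfl
    rw [this]
    exact .iUnion fun h => (hE h).inter (measurable_const_smul h.1 hC)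
  -- It suffices that almost all of `S ⁻¹' C` lies in `N`. On the rest, where `f` takes values in `V
  -- n`, elements of `H` in `V n` never lead into `C`; hence, outside null sets, neither does `f x ∈
  -- V n`, although `f x • x = S x ∈ C`.
  have hnull : ∀ n, μ ((S ⁻¹' C \ N) ∩ f ⁻¹' V n) = 0 := by
    intro n
    obtain ⟨A', -, B', -, hA', hB', hempty⟩ := hsuit.exists_smul_inter_eq_empty hH (hV n)
      (((hS.measurable hC).diff hNm).inter (hf (hV n).measurableSet)) hC fun h hh hhV => by
        convert! measure_empty (μ := μ)
        rw [Set.eq_empty_iff_forall_notMem]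
        rintro _ ⟨⟨y, hy, rfl⟩, hyC⟩
        exact hy.1.2 ⟨⟨h, hh⟩, hVE n ⟨h, hh⟩ hhV hy.2, hyC⟩
    refine measure_mono_null (t := ((S ⁻¹' C \ N) ∩ f ⁻¹' V n) \ A' ∪ S ⁻¹' (C \ B') ∪
      {x | ¬ S x = f x • x}) ?_ (measure_union_null (measure_union_null hA'
        (hS.quasiMeasurePreserving.preimage_null hB')) (ae_iff.1 hSf))
    intro x hx
    by_cases h1 : x ∈ A'
    · by_cases h2 : S x ∈ B'
      · refine Or.inr fun h3 => ?_
        exact Set.eq_empty_iff_forall_notMem.1 hempty (S x)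
          ⟨h3 ▸ Set.smul_mem_smul hx.2 h1, h2⟩
      · exact Or.inl (Or.inr ⟨hx.1.1, h2⟩)
    · exact Or.inl (Or.inl ⟨hx, h1⟩)
  rw [← hS.measure_preimage hC.nullMeasurableSet, ← add_zero (μ N),
    ← measure_iUnion_null hnull]
  refine (measure_mono fun x hx => ?_).trans (measure_union_le _ _)
  by_cases hxN : x ∈ N
  · exact Or.inl hxN
  · obtain ⟨n, hn⟩ := hcover (f x)
    exact Or.inr (Set.mem_iUnion.2 ⟨n, ⟨hx, hxN⟩, hn⟩)

end Hall

/-! ### Approximation in measure and density. -/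

section Density

namespace IsCompatibleBoundedMetric

variable {G : Type*} [τ : TopologicalSpace G] {d : G → G → ℝ}

theorem self_eq_zero (hd : IsCompatibleBoundedMetric d) (g : G) : d g g = 0 :=
  (hd.eq_zero_iff g g).2 rfl

theorem nonneg (hd : IsCompatibleBoundedMetric d) (g h : G) : 0 ≤ d g h := by
  have h1 := hd.triangle g h g
  rw [hd.self_eq_zero, hd.symm h g] at h1
  linarith

theorem isOpen_ball (hd : IsCompatibleBoundedMetric d) (g : G) (r : ℝ) :
    IsOpen {h | d g h < r} := by
  rw [hd.compatible]
  intro h hh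
  exact ⟨r - d g h, sub_pos.2 hh, fun k hk => by
    have := hd.triangle g h k
    change d g k < r
    linarith⟩

theorem exists_countable_cover [SecondCountableTopology G] [Nonempty G]
    (hd : IsCompatibleBoundedMetric d) {δ : ℝ} (hδ : 0 < δ) :
    ∃ V : ℕ → Set G, (∀ n, IsOpen (V n)) ∧ (∀ g, ∃ n, g ∈ V n) ∧
      ∀ n, ∀ g ∈ V n, ∀ h ∈ V n, d g h < δ := by
  refine ⟨fun n => {g | d (TopologicalSpace.denseSeq G n) g < δ / 2},
    fun n => hd.isOpen_ball _ _, fun g => ?_, fun n g hg h hh => ?_⟩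
  · obtain ⟨_, hmem, n, rfl⟩ := (TopologicalSpace.denseRange_denseSeq G).inter_open_nonempty _
      (hd.isOpen_ball g (δ / 2)) ⟨g, by
        change d g g < δ / 2
        rw [hd.self_eq_zero]
        positivity⟩
    refine ⟨n, ?_⟩
    change d _ g < δ / 2
    rw [hd.symm]
    exact hmem
  · have h1 := hd.triangle g (TopologicalSpace.denseSeq G n) h
    rw [hd.symm g (TopologicalSpace.denseSeq G n)] at h1
    have hg' : d (TopologicalSpace.denseSeq G n) g < δ / 2 := hg
    have hh' : d (TopologicalSpace.denseSeq G n) h < δ / 2 := hh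
    linarith

end IsCompatibleBoundedMetric

theorem exists_countable_dense_subgroup_le {G : Type*} [Group G] [TopologicalSpace G]
    [SecondCountableTopology G] {H : Subgroup G} (hH : Dense (H : Set G)) :
    ∃ K ≤ H, Countable K ∧ Dense (K : Set G) := by
  have : SecondCountableTopology H := TopologicalSpace.Subtype.secondCountableTopology (H : Set G)
  obtain ⟨s, hs, hsd⟩ := TopologicalSpace.exists_countable_dense H
  refine ⟨Subgroup.closure (Subtype.val '' s), (Subgroup.closure_le H).2 ?_,
    Set.Countable.to_subtype ?_, ?_⟩
  · rintro _ ⟨h, -, rfl⟩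
    exact h.2
  · have : Countable (Subtype.val '' s : Set G) := (hs.image _).to_subtype
    rw [FreeGroup.closure_eq_range, MonoidHom.coe_range]
    exact Set.countable_range _
  · exact (hH.denseRange_val.dense_image continuous_subtype_val hsd).mono Subgroup.subset_closure

theorem measurable_getD_coe {X G : Type*} [MeasurableSpace X] [Group G] [MeasurableSpace G]
    {H : Subgroup G} [Countable H] {k : X → Option H}
    (hk : ∀ h, MeasurableSet {y | k y = some h}) :
    Measurable fun x => (((k x).getD 1 : H) : G) := by
  intro B _
  have : (fun x => (((k x).getD 1 : H) : G)) ⁻¹' B = ({y | k y = none} ∩ {_y | 1 ∈ B}) ∪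
      ⋃ h : H, {y | k y = some h} ∩ {_y | h.1 ∈ B} := by
    ext x
    cases h : k x with
    | none => simp [h]
    | some γ => simp [h]
  rw [this]
  exact ((measurableSet_eq_none hk).inter (.const _)).union
    (.iUnion fun h => (hk h).inter (.const _))

theorem exists_measurable_ae_eq_smul {G X : Type*} [Group G] [TopologicalSpace G]
    [PolishSpace G] [MeasurableSpace G] [BorelSpace G] [MeasurableSpace X] [StandardBorelSpace X]
    [MulAction G X] [MeasurableSMul₂ G X] (μ : Measure X) [IsFiniteMeasure μ] {S : X → X}
    (hS : Measurable S) (h : ∀ x, S x ∈ MulAction.orbit G x) :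
    ∃ f : X → G, Measurable f ∧ ∀ᵐ x ∂μ, S x = f x • x := by
  have hP : MeasurableSet {p : X × G | S p.1 = p.2 • p.1} :=
    measurableSet_eq_fun (hS.comp measurable_fst) (measurable_snd.smul measurable_fst)
  exact exists_measurable_ae_mem μ hP fun x => (h x).imp fun g hg => hg.symm

variable {G : Type*} [Group G] [TopologicalSpace G] [IsTopologicalGroup G]
  [PolishSpace G] [MeasurableSpace G] [BorelSpace G]
  {X : Type*} [MeasurableSpace X] [StandardBorelSpace X]
  [MulAction G X] [MeasurableSMul₂ G X]

/-- Every measure-preserving bijection along the orbits of `G` is approximated in measure by ones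
along the orbits of a countable dense subgroup. -/
theorem IsSuitable.exists_approximation {μ : Measure X} [IsProbabilityMeasure μ]
    [SMulInvariantMeasure G X μ] (hsuit : IsSuitable G μ) {H : Subgroup G} [Countable H]
    (hH : Dense (H : Set G)) {d : G → G → ℝ} (hd : IsCompatibleBoundedMetric d) {S : X → X}
    (hS : MeasurePreserving S μ μ) {f : X → G} (hf : Measurable f)
    (hSf : ∀ᵐ x ∂μ, S x = f x • x) {ε : ℝ} (hε : 0 < ε) :
    ∃ (S' : mpBij μ) (f' : X → G), Measurable f' ∧ (∀ x, S'.1 x ∈ MulAction.orbit H x) ∧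
      (∀ᵐ x ∂μ, S'.1 x = f' x • x) ∧ ∫ x, d (f x) (f' x) ∂μ < ε := by
  obtain ⟨C, hC⟩ := hd.bounded
  have hC0 : 0 ≤ C := (hd.nonneg 1 1).trans (hC 1 1)
  obtain ⟨V, hVo, hVc, hVd⟩ := hd.exists_countable_cover (half_pos hε)
  let E : H → Set X := fun h => f ⁻¹' {g | d h.1 g < ε / 2}
  have hE : ∀ h, MeasurableSet (E h) := fun h => hf (hd.isOpen_ball _ _).measurableSet
  let e : H → X ≃ᵐ X := MeasurableEquiv.smul
  have he : ∀ h, MeasurePreserving (e h) μ μ := fun h => measurePreserving_smul h μ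
  -- An exceptional set of this measure contributes less than `ε / 2` to the integral; the `+ 1`
  -- allows `C = 0`.
  have hη : 0 < ε / (2 * (C + 1)) := by positivity
  obtain ⟨m, hm, hmE, hminj, hmη⟩ := exists_matching he hE
    (fun A hA => hsuit.measure_le_measure_neighbours hH hS hf hSf hVo hVc hE
      (fun n h hh x hx => hVd n _ hh _ hx) hA) (ENNReal.ofReal_pos.2 hη).ne'
  obtain ⟨k, hk, hmk, hkinj, hknone⟩ := exists_extension (μ := μ) hm hminj
  obtain ⟨S', hS'orb, hS'⟩ := exists_mpBij_of_partner hk hkinj hknone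
  refine ⟨S', fun x => ((k x).getD 1).1, measurable_getD_coe hk, hS'orb, hS', ?_⟩
  have hnm : MeasurableSet {y | m y = none} := measurableSet_eq_none hm
  have hint : Integrable (fun x => ε / 2 + {y | m y = none}.indicator (fun _ => C) x) μ :=
    (integrable_const _).add ((integrable_const C).indicator hnm)
  have hle : ∀ x, d (f x) ((k x).getD 1).1 ≤
      ε / 2 + {y | m y = none}.indicator (fun _ => C) x := by
    intro x
    cases h : m x with
    | none =>
      rw [Set.indicator_of_mem (show x ∈ {y | m y = none} from h)]
      have := hC (f x) ((k x).getD 1).1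
      linarith
    | some γ =>
      rw [Set.indicator_of_notMem (by simp [h]), hmk x γ h, hd.symm, add_zero]
      exact (hmE x γ h : d γ.1 (f x) < ε / 2).le
  refine (integral_mono_of_nonneg (.of_forall fun x => hd.nonneg _ _) hint
    (.of_forall hle)).trans_lt ?_
  rw [integral_add (integrable_const _) ((integrable_const C).indicator hnm),
    integral_indicator_const _ hnm, integral_const, probReal_univ, one_smul, smul_eq_mul]
  have hreal : μ.real {y | m y = none} ≤ ε / (2 * (C + 1)) :=
    ENNReal.toReal_le_of_le_ofReal hη.le hmη
  have h1 : μ.real {y | m y = none} * C ≤ ε / (2 * (C + 1)) * C :=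
    mul_le_mul_of_nonneg_right hreal hC0
  have h2 : ε / (2 * (C + 1)) * C < ε / 2 := by
    rw [div_mul_eq_mul_div, div_lt_div_iff₀ (by positivity) two_pos]
    nlinarith
  linarith

end Density

end OrbitFullGroup

theorem mainTheorem4 {G : Type*} [Group G] [TopologicalSpace G] [IsTopologicalGroup G]
    [PolishSpace G] [MeasurableSpace G] [BorelSpace G]
    {X : Type*} [MeasurableSpace X] [StandardBorelSpace X]
    (μ : Measure X) [IsProbabilityMeasure μ] [NullSingletonClass μ]
    [MulAction G X] [MeasurableSMul₂ G X] [SMulInvariantMeasure G X μ]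
    (hsuit : OrbitFullGroup.IsSuitable G μ)
    (H : Subgroup G) (hH : Dense (H : Set G))
    (d : G → G → ℝ) (hd : OrbitFullGroup.IsCompatibleBoundedMetric d) :
    @Dense (OrbitFullGroup.orbitFullGroup G μ) (OrbitFullGroup.convergenceInMeasure μ d)
      ((OrbitFullGroup.orbitFullGroup H μ).subgroupOf (OrbitFullGroup.orbitFullGroup G μ) :
        Set (OrbitFullGroup.orbitFullGroup G μ)) := by
  open OrbitFullGroup in
  obtain ⟨K, hKH, hK, hKd⟩ := exists_countable_dense_subgroup_le hH
  refine (@dense_iff_inter_open _ (convergenceInMeasure μ d) _).2 ?_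
  rintro U hU ⟨T, hTU⟩
  obtain ⟨S, hSorb, hST⟩ := mem_orbitFullGroup.1 T.2
  obtain ⟨f, hf, hSf⟩ := exists_measurable_ae_eq_smul μ S.2.1.measurable hSorb
  let F : X →ₘ[μ] G := AEEqFun.mk f hf.aestronglyMeasurable
  have hFf : F =ᵐ[μ] f := AEEqFun.coeFn_mk f _
  have hFT : Represents F T.1 := ⟨S, hST, by
    filter_upwards [hSf, hFf] with x h1 h2
    rw [h1, h2]⟩
  have hF : Phi G μ ⟨F, T.1, T.2, hFT⟩ = T := (Phi_eq_iff _ _).2 hFT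
  -- In the quotient topology it is enough to approximate one lift of `T` inside the preimage of
  -- `U`.
  have hUpre := (@isOpen_coinduced _ _ (distTopology fun f g : liftFullGroup G μ =>
    ∫ x, d (f.1 x) (g.1 x) ∂μ) _ _).1 hU
  obtain ⟨ε, hε, hball⟩ := hUpre ⟨F, T.1, T.2, hFT⟩ (by rwa [Set.mem_preimage, hF])
  obtain ⟨S', f', hf', hS'orb, hSf', hlt⟩ :=
    hsuit.exists_approximation hKd hd S.2.1 hf hSf hε
  let F' : X →ₘ[μ] G := AEEqFun.mk f' hf'.aestronglyMeasurable
  have hFf' : F' =ᵐ[μ] f' := AEEqFun.coeFn_mk f' _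
  have hmemH : (QuotientGroup.mk S' : Aut μ) ∈ orbitFullGroup H μ :=
    mem_orbitFullGroup.2 ⟨S', fun x => by
      obtain ⟨h, hh⟩ := hS'orb x
      exact ⟨⟨h.1, hKH h.2⟩, hh⟩, rfl⟩
  let T' : orbitFullGroup G μ := ⟨_, orbitFullGroup_subgroup_le H μ hmemH⟩
  have hFT' : Represents F' T'.1 := ⟨S', rfl, by
    filter_upwards [hSf', hFf'] with x h1 h2
    rw [h1, h2]⟩
  have hF' : Phi G μ ⟨F', T'.1, T'.2, hFT'⟩ = T' := (Phi_eq_iff _ _).2 hFT'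
  refine ⟨T', ?_, hmemH⟩
  have hmem := hball ⟨F', T'.1, T'.2, hFT'⟩ (by
    refine lt_of_eq_of_lt (integral_congr_ae ?_) hlt
    filter_upwards [hFf, hFf'] with x h1 h2
    rw [h1, h2])
  rwa [Set.mem_preimage, hF'] at hmem
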